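/- **Setting.** Let $A\in\mathbb R^{n\times n}$, $B\in\mathbb R^{n\times k}$, $Q\in\mathbb R^{n\times n}$ symmetric positive semidefinite, $R\in\mathbb R^{k\times k}$ symmetric positive definite, $\gamma\in(0,1)$, $\tau>0$. Let $x_{t+1}=Ax_t+Bu_t+w_t$ with $x_0\sim\mathcal D$ and i.i.d. zero-mean noise $w_t$; $\mathcal D$ and the noise have finite second moments, $W=\mathbb E[w_tw_t^\top]$, and $\mu:=\sigma_{\min}(\mathbb E[x_0x_0^\top])>0$. Here $\|\cdot\|$ is the spectral norm and $\sigma_{\min}$ the smallest singular value. For $K\in\mathbb R^{k\times n}$ and $\Sigma\succ0$ let $\pi_{K,\Sigma}(\cdot\mid x)=\mathcal N(-Kx,\Sigma)$ and, with $u_t\sim\pi_{K,\Sigma}(\cdot\mid x_t)$, put $$C(K,\Sigma)=\mathbb E\Big[\sum_{t\ge0}\gamma^t\big(x_t^\top Qx_t+u_t^\top Ru_t+\tau\log\pi_{K,\Sigma}(u_t\mid x_t)\big)\Big],\qquad S_{K,\Sigma}=\mathbb E\Big[\sum_{t\ge0}\gamma^tx_tx_t^\top\Big].$$ Let $P_K=\sum_{t\ge0}\gamma^t((A-BK)^\top)^t(Q+K^\top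 RK)(A-BK)^t$, the matrix of the value function of gain $K$ (it solves $P_K=Q+K^\top RK+\gamma(A-BK)^\top P_K(A-BK)$), and $E_K=-\gamma B^\top P_K(A-BK)+RK$. Let $P\succeq0$ and let $K^*=\gamma(R+\gamma B^\top PB)^{-1}B^\top PA$, $\Sigma^*=\frac\tau2(R+\gamma B^\top PB)^{-1}$ be the associated parameters (those of the optimal policy), where $P$ solves the Riccati equation $P=Q+K^{*\top}RK^*+\gamma(A-BK^*)^\top P(A-BK^*)$. Assume $\|A-BK^*\|\le\rho$ for some $\rho\in(0,1/\sqrt\gamma)$. Write $C^*=C(K^*,\Sigma^*)$ and $S^*=S_{K^*,\Sigma^*}$. **Theorem.** Let $\tau\in(0,2\sigma_{\min}(R)]$, and let $(K^{(0)},\Sigma^{(0)})$ satisfy $0\prec\Sigma^{(0)}\preceq I$ and $C_0:=C(K^{(0)},\Sigma^{(0)})<\infty$. Put $M_\tau=\frac{\tau k}{2(1-\gamma)}\log\frac{\sigma_{\min}(R)}{\pi\tau}$ and let $r_0$ be any number with $$r_0\ \ge\ \max\Big\{\frac{\tau}{2\sigma_{\min}(\Sigma^{(0)})},\ \|R\|+\gamma\,\frac{\|B^\top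 B\|\,(C_0-M_\tau)}{\mu+\frac{\gamma}{1-\gamma}\sigma_{\min}(W)}\Big\}$$ (for instance equality). Set $\eta_1=\frac1{2r_0}$, $\eta_2=\frac{\tau(1-\gamma)}{2r_0^2}$, $a=\frac{\tau}{2r_0}$, and define the regularized policy gradient iterates $$K^{(t+1)}=K^{(t)}-2\eta_1E_{K^{(t)}},\qquad \Sigma^{(t+1)}=\Sigma^{(t)}-\frac{\eta_2}{1-\gamma}\Sigma^{(t)}\Big(R+\gamma B^\top P_{K^{(t)}}B-\frac\tau2(\Sigma^{(t)})^{-1}\Big)\Sigma^{(t)}.$$ Then $C^*$ and all $C(K^{(t)},\Sigma^{(t)})$ are finite; $aI\preceq\Sigma^{(t)}\preceq I$ for all $t\ge0$; with $$\zeta=\min\Big\{\frac{\mu\,\sigma_{\min}(R)}{\|S^*\|\,r_0},\ \frac{\tau^2\sigma_{\min}(R)}{8r_0^3}\Big\}$$ one has $0<\zeta<1$ and $C(K^{(t+1)},\Sigma^{(t+1)})-C^*\le(1-\zeta)\,(C(K^{(t)},\Sigma^{(t)})-C^*)$ for all $t\ge0$; and for every $\varepsilon>0$ and every integer $N\ge0$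 with $$N\ \ge\ \max\Big\{\frac{\|S^*\|\,r_0}{\mu\,\sigma_{\min}(R)},\ \frac{8r_0^3}{\tau^2\sigma_{\min}(R)}\Big\}\log\frac{C_0-C^*}{\varepsilon}$$ one has $C(K^{(N)},\Sigma^{(N)})-C^*\le\varepsilon$. (If $C_0\le C^*$ the last bound holds for every $N\ge0$.) -/

import Mathlib

open MeasureTheory ProbabilityTheory

open scoped Matrix ENNReal

noncomputable section

namespace LQC

/-- `ℝᵈ` with its Euclidean structure. -/
abbrev Vec (d : ℕ) : Type := EuclideanSpace ℝ (Fin d)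

/-- The spectral norm of a square matrix: its operator norm on Euclidean space. -/
def specNorm {d : ℕ} (M : Matrix (Fin d) (Fin d) ℝ) : ℝ :=
  ‖Matrix.toEuclideanCLM (𝕜 := ℝ) M‖

/-- The smallest singular value of a `d × d` matrix. Singular values are listed in decreasing
order from index `0`, so it is the one of index `d - 1`. -/
def sigmaMin {d : ℕ} (M : Matrix (Fin d) (Fin d) ℝ) : ℝ :=
  (Matrix.toEuclideanLin M).singularValues (d - 1)

/-- The second moment matrix `𝔼[x xᵀ]` for `x ∼ m`. -/
def secondMoment {d : ℕ} (m : Measure (Vec d)) : Matrix (Fin d) (Fin d) ℝ :=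
  Matrix.of fun i j => ∫ x, x i * x j ∂m

/-- The density at `u` of the Gaussian distribution `𝒩(m, S)` on `ℝᵈ`, `S` positive definite. -/
def gaussianDensity {d : ℕ} (m : Vec d) (S : Matrix (Fin d) (Fin d) ℝ) (u : Vec d) : ℝ :=
  (Real.sqrt ((2 * Real.pi) ^ d * S.det))⁻¹ *
    Real.exp (-(1 / 2) * ((u - m).ofLp ⬝ᵥ S⁻¹ *ᵥ (u - m).ofLp))

/-- An entropy-regularized discounted linear-quadratic control problem with state space `ℝⁿ` and
action space `ℝᵏ`: dynamics `x_{t+1} = A x_t + B u_t + w_t`, `x_0 ∼ init`, with i.i.d. zero-mean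
noise `w_t ∼ noise` of finite second moment, stage cost `xᵀQx + uᵀRu + τ log π(u|x)`,
discount factor `γ`. -/
structure Model (n k : ℕ) where
  /-- state matrix -/
  A : Matrix (Fin n) (Fin n) ℝ
  /-- control matrix -/
  B : Matrix (Fin n) (Fin k) ℝ
  /-- state cost -/
  Q : Matrix (Fin n) (Fin n) ℝ
  /-- control cost -/
  R : Matrix (Fin k) (Fin k) ℝ
  /-- distribution of the initial state -/
  init : Measure (Vec n)
  /-- distribution of one noise variable -/
  noise : Measure (Vec n)
  /-- discount factor -/
  γ : ℝ
  /-- regularization parameter -/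
  τ : ℝ
  Q_posSemidef : Q.PosSemidef
  R_posDef : R.PosDef
  init_prob : IsProbabilityMeasure init
  init_memLp : MemLp (fun x : Vec n => x) 2 init
  noise_prob : IsProbabilityMeasure noise
  noise_memLp : MemLp (fun w : Vec n => w) 2 noise
  noise_mean : ∫ w, w ∂noise = 0
  γ_pos : 0 < γ
  γ_lt_one : γ < 1
  τ_pos : 0 < τ

attribute [instance] Model.init_prob Model.noise_prob

/-- The Gaussian policy `π_{K,S}(· | x) = 𝒩(-Kx, S)`. -/
def policy {n k : ℕ} (K : Matrix (Fin k) (Fin n) ℝ) (S : Matrix (Fin k) (Fin k) ℝ) :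
    Kernel (Vec n) (Vec k) where
  toFun x := multivariateGaussian (-Matrix.toEuclideanLin K x) S
  measurable' := by
    obtain ⟨L, hL⟩ : ∃ L : Vec k →L[ℝ] Vec k, ∀ m, multivariateGaussian m S =
        (stdGaussian (Vec k)).map fun v => m + L v := ⟨_, fun _ => rfl⟩
    have hm : Measurable fun p : Vec n × Vec k => -Matrix.toEuclideanLin K p.1 + L p.2 := by
      have h1 : Continuous (Matrix.toEuclideanLin K) :=
        LinearMap.continuous_of_finiteDimensional _
      fun_prop
    refine Measure.measurable_of_measurable_coe _ fun s hs => ?_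
    have heq : (fun x : Vec n => multivariateGaussian (-Matrix.toEuclideanLin K x) S s) =
        fun x => stdGaussian (Vec k) (Prod.mk x ⁻¹'
          ((fun p : Vec n × Vec k => -Matrix.toEuclideanLin K p.1 + L p.2) ⁻¹' s)) := by
      funext x
      rw [hL, Measure.map_apply (by fun_prop) hs]
      rfl
    rw [heq]
    exact measurable_measure_prodMk_left (hm hs)

instance {n k : ℕ} (K : Matrix (Fin k) (Fin n) ℝ) (S : Matrix (Fin k) (Fin k) ℝ) :
    IsMarkovKernel (policy K S) :=
  ⟨fun x => inferInstanceAs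
    (IsProbabilityMeasure (multivariateGaussian (-Matrix.toEuclideanLin K x) S))⟩

namespace Model

variable {n k : ℕ} (𝓜 : Model n k)

/-- `W = 𝔼[w wᵀ]`. -/
def W : Matrix (Fin n) (Fin n) ℝ := secondMoment 𝓜.noise

/-- `μ = σ_min(𝔼[x₀ x₀ᵀ])`. -/
def μ : ℝ := sigmaMin (secondMoment 𝓜.init)

/-- Transition kernel of the state: given `(x, u)`, the next state is `A x + B u + w`,
`w ∼ noise`. -/
def transition : Kernel (Vec n × Vec k) (Vec n) where
  toFun p := 𝓜.noise.map fun w =>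
    Matrix.toEuclideanLin 𝓜.A p.1 + Matrix.toEuclideanLin 𝓜.B p.2 + w
  measurable' := by
    have hm : Measurable fun q : (Vec n × Vec k) × Vec n =>
        Matrix.toEuclideanLin 𝓜.A q.1.1 + Matrix.toEuclideanLin 𝓜.B q.1.2 + q.2 := by
      have h1 : Continuous (Matrix.toEuclideanLin 𝓜.A) :=
        LinearMap.continuous_of_finiteDimensional _
      have h2 : Continuous (Matrix.toEuclideanLin 𝓜.B) :=
        LinearMap.continuous_of_finiteDimensional _
      fun_prop
    refine Measure.measurable_of_measurable_coe _ fun s hs => ?_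
    have heq : (fun p : Vec n × Vec k => (𝓜.noise.map fun w =>
          Matrix.toEuclideanLin 𝓜.A p.1 + Matrix.toEuclideanLin 𝓜.B p.2 + w) s) =
        fun p => 𝓜.noise (Prod.mk p ⁻¹' ((fun q : (Vec n × Vec k) × Vec n =>
          Matrix.toEuclideanLin 𝓜.A q.1.1 + Matrix.toEuclideanLin 𝓜.B q.1.2 + q.2) ⁻¹' s)) := by
      funext p
      rw [Measure.map_apply (by fun_prop) hs]
      rfl
    rw [heq]
    exact measurable_measure_prodMk_left (hm hs)

instance : IsMarkovKernel 𝓜.transition :=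
  ⟨fun _ => Measure.isProbabilityMeasure_map (by fun_prop)⟩

/-- One step of the state-action chain under `π_{K,S}`: from `(x, u)` draw the next state `x'`,
then the next action `u' ∼ π_{K,S}(· | x')`. -/
def step (K : Matrix (Fin k) (Fin n) ℝ) (S : Matrix (Fin k) (Fin k) ℝ) :
    Kernel (Vec n × Vec k) (Vec n × Vec k) :=
  𝓜.transition ⊗ₖ (policy K S).prodMkLeft (Vec n × Vec k)

instance (K : Matrix (Fin k) (Fin n) ℝ) (S : Matrix (Fin k) (Fin k) ℝ) :
    IsMarkovKernel (𝓜.step K S) := by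
  unfold step
  infer_instance

/-- The law of the whole state-action trajectory `((x_t, u_t))_t` under the policy `π_{K,S}` with
`x_0 ∼ init`. -/
def pathLaw (K : Matrix (Fin k) (Fin n) ℝ) (S : Matrix (Fin k) (Fin k) ℝ) :
    Measure (ℕ → Vec n × Vec k) :=
  Kernel.trajMeasure (X := fun _ => Vec n × Vec k) (𝓜.init ⊗ₘ policy K S)
    fun t => (𝓜.step K S).comap
      (fun h : (i : Finset.Iic t) → Vec n × Vec k => h ⟨t, Finset.mem_Iic.2 le_rfl⟩)
      (measurable_pi_apply _)

/-- Regularized stage cost `xᵀQx + uᵀRu + τ log π_{K,S}(u | x)`. -/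
def stageCost (K : Matrix (Fin k) (Fin n) ℝ) (S : Matrix (Fin k) (Fin k) ℝ)
    (z : Vec n × Vec k) : ℝ :=
  z.1.ofLp ⬝ᵥ 𝓜.Q *ᵥ z.1.ofLp + z.2.ofLp ⬝ᵥ 𝓜.R *ᵥ z.2.ofLp +
    𝓜.τ * Real.log (gaussianDensity (-Matrix.toEuclideanLin K z.1) S z.2)

/-- The objective `𝔼[∑_t γᵗ c_t]` as an extended real number: the expected discounted sum of the
positive parts of the stage costs minus that of the negative parts. -/
def costE (K : Matrix (Fin k) (Fin n) ℝ) (S : Matrix (Fin k) (Fin k) ℝ) : EReal :=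
  ((∫⁻ ω, ∑' t : ℕ, ENNReal.ofReal (𝓜.γ ^ t * 𝓜.stageCost K S (ω t)) ∂𝓜.pathLaw K S : ℝ≥0∞) :
      EReal) -
    ((∫⁻ ω, ∑' t : ℕ, ENNReal.ofReal (-(𝓜.γ ^ t * 𝓜.stageCost K S (ω t)))
      ∂𝓜.pathLaw K S : ℝ≥0∞) : EReal)

/-- The objective `C(K, S)` as a real number; meaningful where `costE` is finite. -/
def cost (K : Matrix (Fin k) (Fin n) ℝ) (S : Matrix (Fin k) (Fin k) ℝ) : ℝ :=
  (𝓜.costE K S).toReal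

/-- The discounted state correlation matrix `𝔼[∑_t γᵗ x_t x_tᵀ]` under `π_{K,S}`. -/
def stateCorr (K : Matrix (Fin k) (Fin n) ℝ) (S : Matrix (Fin k) (Fin k) ℝ) :
    Matrix (Fin n) (Fin n) ℝ :=
  Matrix.of fun i j =>
    ∫ ω, ∑' t : ℕ, 𝓜.γ ^ t * ((ω t).1 i * (ω t).1 j) ∂𝓜.pathLaw K S

/-- The matrix `P_K` of the quadratic part of the value function of a policy with gain `K`,
`P_K = ∑_t γᵗ ((A - BK)ᵀ)ᵗ (Q + KᵀRK) (A - BK)ᵗ`. -/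
def valueMatrix (K : Matrix (Fin k) (Fin n) ℝ) : Matrix (Fin n) (Fin n) ℝ :=
  ∑' t : ℕ, 𝓜.γ ^ t •
    (((𝓜.A - 𝓜.B * K)ᵀ) ^ t * (𝓜.Q + Kᵀ * 𝓜.R * K) * (𝓜.A - 𝓜.B * K) ^ t)

/-- Where its series converges, `P_K` satisfies the Bellman equation
`P_K = Q + KᵀRK + γ (A - BK)ᵀ P_K (A - BK)`. -/
theorem valueMatrix_eq (K : Matrix (Fin k) (Fin n) ℝ)
    (h : Summable fun t : ℕ => 𝓜.γ ^ t •
      (((𝓜.A - 𝓜.B * K)ᵀ) ^ t * (𝓜.Q + Kᵀ * 𝓜.R * K) * (𝓜.A - 𝓜.B * K) ^ t)) :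
    𝓜.valueMatrix K = 𝓜.Q + Kᵀ * 𝓜.R * K +
      𝓜.γ • ((𝓜.A - 𝓜.B * K)ᵀ * 𝓜.valueMatrix K * (𝓜.A - 𝓜.B * K)) := by
  have h2 := h.tsum_eq_zero_add
  have h3 : (fun t : ℕ => 𝓜.γ ^ (t + 1) • (((𝓜.A - 𝓜.B * K)ᵀ) ^ (t + 1) *
      (𝓜.Q + Kᵀ * 𝓜.R * K) * (𝓜.A - 𝓜.B * K) ^ (t + 1))) = fun t : ℕ =>
      𝓜.γ • ((𝓜.A - 𝓜.B * K)ᵀ * (𝓜.γ ^ t • (((𝓜.A - 𝓜.B * K)ᵀ) ^ t *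
        (𝓜.Q + Kᵀ * 𝓜.R * K) * (𝓜.A - 𝓜.B * K) ^ t)) * (𝓜.A - 𝓜.B * K)) := by
    funext t
    rw [pow_succ' 𝓜.γ, pow_succ' ((𝓜.A - 𝓜.B * K)ᵀ), pow_succ (𝓜.A - 𝓜.B * K)]
    simp only [Matrix.mul_smul, Matrix.smul_mul, smul_smul, Matrix.mul_assoc]
  have h4 : HasSum (fun t : ℕ => 𝓜.γ • ((𝓜.A - 𝓜.B * K)ᵀ * (𝓜.γ ^ t •
      (((𝓜.A - 𝓜.B * K)ᵀ) ^ t * (𝓜.Q + Kᵀ * 𝓜.R * K) * (𝓜.A - 𝓜.B * K) ^ t)) *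
        (𝓜.A - 𝓜.B * K)))
      (𝓜.γ • ((𝓜.A - 𝓜.B * K)ᵀ * 𝓜.valueMatrix K * (𝓜.A - 𝓜.B * K))) :=
    ((h.hasSum.mul_left _).mul_right _).const_smul _
  rw [h3, h4.tsum_eq] at h2
  simpa [valueMatrix] using h2

/-- `E_K = -γ Bᵀ P_K (A - BK) + R K`. -/
def gradGain (K : Matrix (Fin k) (Fin n) ℝ) : Matrix (Fin k) (Fin n) ℝ :=
  -(𝓜.γ • (𝓜.Bᵀ * 𝓜.valueMatrix K * (𝓜.A - 𝓜.B * K))) + 𝓜.R * K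

/-- One step of the regularized policy gradient update with step sizes `η₁`, `η₂`. -/
def rpgStep (η₁ η₂ : ℝ) (θ : Matrix (Fin k) (Fin n) ℝ × Matrix (Fin k) (Fin k) ℝ) :
    Matrix (Fin k) (Fin n) ℝ × Matrix (Fin k) (Fin k) ℝ :=
  (θ.1 - (2 * η₁) • 𝓜.gradGain θ.1,
    θ.2 - (η₂ / (1 - 𝓜.γ)) •
      (θ.2 * (𝓜.R + 𝓜.γ • (𝓜.Bᵀ * 𝓜.valueMatrix θ.1 * 𝓜.B) - (𝓜.τ / 2) • θ.2⁻¹) * θ.2))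

/-- The iterates `(K⁽ᵗ⁾, Σ⁽ᵗ⁾)` of the regularized policy gradient method. -/
def rpg (η₁ η₂ : ℝ) (θ₀ : Matrix (Fin k) (Fin n) ℝ × Matrix (Fin k) (Fin k) ℝ) (t : ℕ) :
    Matrix (Fin k) (Fin n) ℝ × Matrix (Fin k) (Fin k) ℝ :=
  (𝓜.rpgStep η₁ η₂)^[t] θ₀

/-- `K* = γ (R + γ BᵀPB)⁻¹ BᵀPA`. -/
def optGain (P : Matrix (Fin n) (Fin n) ℝ) : Matrix (Fin k) (Fin n) ℝ :=
  𝓜.γ • ((𝓜.R + 𝓜.γ • (𝓜.Bᵀ * P * 𝓜.B))⁻¹ * 𝓜.Bᵀ * P * 𝓜.A)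

/-- `Σ* = (τ/2) (R + γ BᵀPB)⁻¹`. -/
def optCov (P : Matrix (Fin n) (Fin n) ℝ) : Matrix (Fin k) (Fin k) ℝ :=
  (𝓜.τ / 2) • (𝓜.R + 𝓜.γ • (𝓜.Bᵀ * P * 𝓜.B))⁻¹

/-- `P` is a positive semidefinite solution of the Riccati equation
`P = Q + K*ᵀ R K* + γ (A - BK*)ᵀ P (A - BK*)`, where `K*` is determined by `P`. -/
def IsRiccatiSolution (P : Matrix (Fin n) (Fin n) ℝ) : Prop :=
  P.PosSemidef ∧
    P = 𝓜.Q + (𝓜.optGain P)ᵀ * 𝓜.R * 𝓜.optGain P +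
      𝓜.γ • ((𝓜.A - 𝓜.B * 𝓜.optGain P)ᵀ * P * (𝓜.A - 𝓜.B * 𝓜.optGain P))

/-- `M_τ = τ k / (2 (1 - γ)) · log (σ_min(R) / (π τ))`. -/
def entropyConst : ℝ :=
  𝓜.τ * k / (2 * (1 - 𝓜.γ)) * Real.log (sigmaMin 𝓜.R / (Real.pi * 𝓜.τ))

/-- The quantity `max {τ / (2 σ_min(S)), ‖R‖ + γ ‖BᵀB‖ (C(K, S) - M_τ) / (μ + γ/(1-γ) σ_min(W))}`
of an initial pair `(K, S)`. -/
def radius (K : Matrix (Fin k) (Fin n) ℝ) (S : Matrix (Fin k) (Fin k) ℝ) : ℝ :=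
  max (𝓜.τ / (2 * sigmaMin S))
    (specNorm 𝓜.R + 𝓜.γ * (specNorm (𝓜.Bᵀ * 𝓜.B) * (𝓜.cost K S - 𝓜.entropyConst) /
      (𝓜.μ + 𝓜.γ / (1 - 𝓜.γ) * sigmaMin 𝓜.W)))

end Model

end LQC

end

/-! The cost separates into two coupled pieces. When the series for `P = P_K` converges, `C(K,Σ)`
equals `tr(P 𝔼[x₀x₀ᵀ]) + γ/(1-γ) tr(P W) + (1-γ)⁻¹ (f_P(Σ) - const)`, where `f_P(Σ) = tr(GΣ) - (τ/2)
log det Σ` and `G = R + γBᵀPB` (`closedCost`, `covObjective`, `controlHessian`). This is monotone in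
`P`, and for fixed `P` it is a log-determinant problem in `Σ` with minimizer `(τ/2)G⁻¹`. Conversely,
finite cost forces the series to converge because `𝔼[x₀x₀ᵀ] ⪰ μI`.

Gain. The Bellman operator is exactly quadratic in `K`, with gradient `E_K` and Hessian `G`
(`bellman_add_eq`). If `G ⪯ r₀I`, a step of length `1/r₀` turns `P_K` into a supersolution for the
new gain, so `P_{K'} ⪯ P_K - r₀⁻¹EᵀE` (`gradientStep_valueMatrix_le`), and the cost drops by at
least `(μ/r₀) tr EᵀE`.

Covariance. With `T = √Σ` and `N = (2/τ)TGT` the update reads `Σ' = T(1 - a²(N-1))T`, so progress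
and gap are both sums over eigenvalues of `N`, and a scalar inequality gives contraction of `f_P`
(`covariance_scalar_decrease`, `covStep_decrease`). The interval `aI ⪯ Σ ⪯ I` is invariant
(`covStep_mem`) and confines that spectrum.

Comparison. The cost of `(K*,Σ*)` can be written through the Bellman residual of `P_K` along the
trajectory of `K*` (`costE_eq_closedCost_add`). Completing the square bounds the gap by the
covariance gap plus `‖S*‖/σ_min(R) · tr EᵀE` (`closedCost_sub_le`). The one-step decrease dominates
`ζ` times this bound (`step_decrease`).

Closing the loop. A lower bound on the cost that is linear in `tr P` (`closedCost_ge`) shows that `G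
⪯ r₀I` holds wherever the cost is at most `C₀`. Since each step does not raise the cost, this
persists by induction. -/

open scoped MatrixOrder

namespace LQC

/-! ### Loewner order, traces and orthogonal diagonalization. -/

section Loewner

set_option linter.unusedSectionVars false

variable {ι κ : Type*} [Fintype ι] [Fintype κ]

theorem conj_nonneg {M : Matrix ι ι ℝ} (h : 0 ≤ M) (F : Matrix ι κ ℝ) : 0 ≤ Fᵀ * M * F := by
  have := (Matrix.nonneg_iff_posSemidef.1 h).conjTranspose_mul_mul_same F
  rwa [Matrix.conjTranspose_eq_transpose_of_trivial, ← Matrix.nonneg_iff_posSemidef] at this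

theorem conj_le {M N : Matrix ι ι ℝ} (h : M ≤ N) (F : Matrix ι κ ℝ) :
    Fᵀ * M * F ≤ Fᵀ * N * F := by
  rw [← sub_nonneg] at h ⊢
  have := conj_nonneg h F
  rwa [Matrix.mul_sub, Matrix.sub_mul] at this

theorem conj_nonneg' {M : Matrix ι ι ℝ} (h : 0 ≤ M) (F : Matrix κ ι ℝ) : 0 ≤ F * M * Fᵀ := by
  simpa using conj_nonneg h Fᵀ

theorem conj_le' {M N : Matrix ι ι ℝ} (h : M ≤ N) (F : Matrix κ ι ℝ) :
    F * M * Fᵀ ≤ F * N * Fᵀ := by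
  simpa using conj_le h Fᵀ

theorem transpose_mul_self_nonneg (F : Matrix ι κ ℝ) : 0 ≤ Fᵀ * F := by
  have := Matrix.posSemidef_conjTranspose_mul_self F
  rwa [Matrix.conjTranspose_eq_transpose_of_trivial, ← Matrix.nonneg_iff_posSemidef] at this

theorem transpose_eq_of_nonneg {M : Matrix ι ι ℝ} (h : 0 ≤ M) : Mᵀ = M := by
  rw [← Matrix.conjTranspose_eq_transpose_of_trivial]
  exact (Matrix.nonneg_iff_posSemidef.1 h).1

theorem smul_matrix_le {M N : Matrix ι ι ℝ} (h : M ≤ N) {c : ℝ} (hc : 0 ≤ c) : c • M ≤ c • N := by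
  rw [Matrix.le_iff, ← smul_sub]
  exact (Matrix.le_iff.1 h).smul hc

theorem smul_matrix_nonneg {M : Matrix ι ι ℝ} (h : 0 ≤ M) {c : ℝ} (hc : 0 ≤ c) : 0 ≤ c • M := by
  simpa using smul_matrix_le h hc

theorem trace_nonneg_of_nonneg {M : Matrix ι ι ℝ} (h : 0 ≤ M) : 0 ≤ M.trace :=
  (Matrix.nonneg_iff_posSemidef.1 h).trace_nonneg

theorem exists_transpose_mul_self {M : Matrix ι ι ℝ} (h : 0 ≤ M) :
    ∃ L : Matrix ι ι ℝ, M = Lᵀ * L := by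
  classical
  refine ⟨CFC.sqrt M, ?_⟩
  rw [transpose_eq_of_nonneg (CFC.sqrt_nonneg M), CFC.sqrt_mul_sqrt_self M h]

/-- Factoring `N = LᵀL` and cycling the trace gives `tr(L M Lᵀ)`, the trace of a positive
semidefinite matrix. -/
theorem trace_mul_nonneg {M N : Matrix ι ι ℝ} (hM : 0 ≤ M) (hN : 0 ≤ N) : 0 ≤ (M * N).trace := by
  obtain ⟨L, rfl⟩ := exists_transpose_mul_self hN
  rw [← Matrix.mul_assoc, Matrix.trace_mul_comm, ← Matrix.mul_assoc]
  exact trace_nonneg_of_nonneg (conj_nonneg' hM L)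

theorem trace_mul_le {M M' N : Matrix ι ι ℝ} (h : M ≤ M') (hN : 0 ≤ N) :
    (M * N).trace ≤ (M' * N).trace := by
  have := trace_mul_nonneg (sub_nonneg.2 h) hN
  rw [Matrix.sub_mul, Matrix.trace_sub] at this
  linarith

theorem trace_mul_le' {M N N' : Matrix ι ι ℝ} (hM : 0 ≤ M) (h : N ≤ N') :
    (M * N).trace ≤ (M * N').trace := by
  rw [Matrix.trace_mul_comm M, Matrix.trace_mul_comm M]
  exact trace_mul_le h hM

theorem nonneg_iff_quadratic {M : Matrix ι ι ℝ} :
    0 ≤ M ↔ Mᵀ = M ∧ ∀ x, 0 ≤ x ⬝ᵥ M *ᵥ x := by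
  rw [Matrix.nonneg_iff_posSemidef, Matrix.posSemidef_iff_dotProduct_mulVec, Matrix.IsHermitian,
    Matrix.conjTranspose_eq_transpose_of_trivial]
  simp

/-- Testing the form on `eᵢ ± eⱼ` gives `2|Mᵢⱼ| ≤ Mᵢᵢ + Mⱼⱼ`. It reduces summability of positive
semidefinite series to summability of traces. -/
theorem abs_apply_le_trace {M : Matrix ι ι ℝ} (h : 0 ≤ M) (i j : ι) : |M i j| ≤ M.trace := by
  classical
  obtain ⟨hs, hq⟩ := nonneg_iff_quadratic.1 h
  have hd : ∀ i, 0 ≤ M i i := fun i => (Matrix.nonneg_iff_posSemidef.1 h).diag_nonneg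
  have hle : ∀ i, M i i ≤ M.trace := fun i =>
    Finset.single_le_sum (f := fun i => M i i) (fun j _ => hd j) (Finset.mem_univ i)
  have hji : M j i = M i j := congrFun (congrFun hs i) j
  have hp := hq (Pi.single i 1 + Pi.single j 1)
  have hm := hq (Pi.single i 1 - Pi.single j 1)
  simp [Matrix.mulVec_add, Matrix.mulVec_sub, add_dotProduct, sub_dotProduct, dotProduct_add, dotProduct_sub, hji] at hp hm
  have := hle i
  have := hle j
  rw [abs_le]
  constructor <;> linarith

variable [DecidableEq ι]

/-- Spectral decomposition of a real symmetric matrix. -/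
theorem exists_orthogonal_diagonal {M : Matrix ι ι ℝ} (h : Mᵀ = M) :
    ∃ (U : Matrix ι ι ℝ) (d : ι → ℝ), Uᵀ * U = 1 ∧ U * Uᵀ = 1 ∧ M = U * Matrix.diagonal d * Uᵀ := by
  have hM : M.IsHermitian := by
    rw [Matrix.IsHermitian, Matrix.conjTranspose_eq_transpose_of_trivial, h]
  refine ⟨hM.eigenvectorUnitary, hM.eigenvalues, ?_, ?_, ?_⟩
  · simpa [Matrix.star_eq_conjTranspose] using Unitary.coe_star_mul_self hM.eigenvectorUnitary
  · simpa [Matrix.star_eq_conjTranspose] using Unitary.coe_mul_star_self hM.eigenvectorUnitary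
  · simpa [Matrix.star_eq_conjTranspose, Function.comp_def, Unitary.conjStarAlgAut_apply] using hM.spectral_theorem

theorem diagonal_le_diagonal_iff {d e : ι → ℝ} :
    Matrix.diagonal d ≤ Matrix.diagonal e ↔ ∀ i, d i ≤ e i := by
  rw [Matrix.le_iff, Matrix.diagonal_sub, Matrix.posSemidef_diagonal_iff]
  simp

theorem orthogonal_conj_le_iff {U M N : Matrix ι ι ℝ} (h : Uᵀ * U = 1) :
    U * M * Uᵀ ≤ U * N * Uᵀ ↔ M ≤ N := by
  refine ⟨fun hl => ?_, fun hl => conj_le' hl U⟩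
  have h1 : ∀ X : Matrix ι ι ℝ, Uᵀ * (U * X * Uᵀ) * U = X := fun X => by
    calc _ = (Uᵀ * U) * X * (Uᵀ * U) := by noncomm_ring
      _ = X := by simp [h]
  simpa [h1] using conj_le hl U

theorem smul_one_eq_diagonal (c : ℝ) : c • (1 : Matrix ι ι ℝ) = Matrix.diagonal fun _ => c := by
  ext i j
  simp [Matrix.one_apply, Matrix.diagonal_apply]

theorem smul_one_eq_conj {U : Matrix ι ι ℝ} (h : U * Uᵀ = 1) (c : ℝ) :
    c • (1 : Matrix ι ι ℝ) = U * Matrix.diagonal (fun _ => c) * Uᵀ := by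
  rw [← smul_one_eq_diagonal]; simp [h]

theorem le_smul_one_iff {U : Matrix ι ι ℝ} {d : ι → ℝ} (h : Uᵀ * U = 1) (h' : U * Uᵀ = 1) (c : ℝ) :
    U * Matrix.diagonal d * Uᵀ ≤ c • (1 : Matrix ι ι ℝ) ↔ ∀ i, d i ≤ c := by
  rw [smul_one_eq_conj h', orthogonal_conj_le_iff h, diagonal_le_diagonal_iff]

theorem smul_one_le_iff {U : Matrix ι ι ℝ} {d : ι → ℝ} (h : Uᵀ * U = 1) (h' : U * Uᵀ = 1) (c : ℝ) :
    c • (1 : Matrix ι ι ℝ) ≤ U * Matrix.diagonal d * Uᵀ ↔ ∀ i, c ≤ d i := by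
  rw [smul_one_eq_conj h', orthogonal_conj_le_iff h, diagonal_le_diagonal_iff]

theorem trace_orthogonal_conj {U : Matrix ι ι ℝ} (h : Uᵀ * U = 1) (M : Matrix ι ι ℝ) :
    (U * M * Uᵀ).trace = M.trace := by
  rw [Matrix.trace_mul_comm, ← Matrix.mul_assoc, h, Matrix.one_mul]

theorem det_orthogonal_conj {U : Matrix ι ι ℝ} (h : U * Uᵀ = 1) (M : Matrix ι ι ℝ) :
    (U * M * Uᵀ).det = M.det := by
  rw [Matrix.det_mul, Matrix.det_mul, mul_right_comm, ← Matrix.det_mul, h, Matrix.det_one, one_mul]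

theorem nonneg_conj_diagonal_iff {U : Matrix ι ι ℝ} {d : ι → ℝ} (h : Uᵀ * U = 1)
    (h' : U * Uᵀ = 1) : 0 ≤ U * Matrix.diagonal d * Uᵀ ↔ ∀ i, 0 ≤ d i := by
  simpa using smul_one_le_iff h h' (d := d) 0

theorem le_trace_smul_one {M : Matrix ι ι ℝ} (h : 0 ≤ M) : M ≤ M.trace • (1 : Matrix ι ι ℝ) := by
  obtain ⟨U, d, h1, h2, rfl⟩ := exists_orthogonal_diagonal (transpose_eq_of_nonneg h)
  rw [trace_orthogonal_conj h1, le_smul_one_iff h1 h2, Matrix.trace_diagonal]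
  rw [nonneg_conj_diagonal_iff h1 h2] at h
  exact fun i => Finset.single_le_sum (fun j _ => h j) (Finset.mem_univ i)

theorem posDef_of_smul_one_le {M : Matrix ι ι ℝ} {c : ℝ} (hc : 0 < c)
    (h : c • (1 : Matrix ι ι ℝ) ≤ M) : M.PosDef := by
  have h1 : (c • (1 : Matrix ι ι ℝ)).PosDef := Matrix.PosDef.one.smul hc
  simpa using h1.add_posSemidef (Matrix.le_iff.1 h)

theorem smul_one_mono {c c' : ℝ} (h : c ≤ c') :
    c • (1 : Matrix ι ι ℝ) ≤ c' • (1 : Matrix ι ι ℝ) := by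
  rw [smul_one_eq_diagonal, smul_one_eq_diagonal, diagonal_le_diagonal_iff]
  exact fun _ => h

/-- The trace inequality behind the Gaussian entropy bound. -/
theorem card_add_log_det_le_trace {Y : Matrix ι ι ℝ} (h : Y.PosDef) :
    Fintype.card ι + Real.log Y.det ≤ Y.trace := by
  obtain ⟨U, d, h1, h2, hY⟩ := exists_orthogonal_diagonal (transpose_eq_of_nonneg h.posSemidef.nonneg)
  have hd : Y.det = ∏ i, d i := by rw [hY, det_orthogonal_conj h2, Matrix.det_diagonal]
  have hnn : ∀ i, 0 ≤ d i := by
    rw [← nonneg_conj_diagonal_iff h1 h2, ← hY]; exact h.posSemidef.nonneg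
  have hpos : ∀ i, d i ≠ 0 := by
    have := h.det_pos.ne'
    rw [hd, Finset.prod_ne_zero_iff] at this
    exact fun i => this i (Finset.mem_univ i)
  rw [hd, hY, trace_orthogonal_conj h1, Matrix.trace_diagonal, Real.log_prod (fun i _ => hpos i)]
  rw [← Finset.card_univ, Finset.card_eq_sum_ones, Nat.cast_sum, ← Finset.sum_add_distrib]
  refine Finset.sum_le_sum fun i _ => ?_
  -- The matrix inequality is `log d ≤ d - 1` summed over the eigenvalues.
  have := Real.log_le_sub_one_of_pos (lt_of_le_of_ne (hnn i) (hpos i).symm)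
  push_cast; linarith

end Loewner

/-! ### Spectral norm and smallest singular value as Loewner bounds. -/

section SingularValue

variable {d : ℕ}

theorem le_specNorm_smul_one {M : Matrix (Fin d) (Fin d) ℝ} (h : Mᵀ = M) :
    M ≤ specNorm M • (1 : Matrix (Fin d) (Fin d) ℝ) := by
  rw [← sub_nonneg, nonneg_iff_quadratic]
  refine ⟨by simp [h], fun x => ?_⟩
  have h1 := real_inner_le_norm (WithLp.toLp 2 x : Vec d) (Matrix.toEuclideanCLM (𝕜 := ℝ) M (WithLp.toLp 2 x))
  have h2 := (Matrix.toEuclideanCLM (𝕜 := ℝ) M).le_opNorm (WithLp.toLp 2 x)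
  have h3 : x ⬝ᵥ x = ‖(WithLp.toLp 2 x : Vec d)‖ ^ 2 := by
    rw [EuclideanSpace.real_norm_sq_eq]; simp [dotProduct, sq]
  rw [Matrix.inner_toEuclideanCLM] at h1
  rw [Matrix.sub_mulVec, dotProduct_sub, Matrix.smul_mulVec, Matrix.one_mulVec, dotProduct_smul, h3, sub_nonneg]
  refine h1.trans ((mul_le_mul_of_nonneg_left h2 (norm_nonneg _)).trans (le_of_eq ?_))
  simp only [specNorm, smul_eq_mul]; ring

theorem specNorm_nonneg (M : Matrix (Fin d) (Fin d) ℝ) : 0 ≤ specNorm M := norm_nonneg _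

theorem sigmaMin_nonneg (M : Matrix (Fin d) (Fin d) ℝ) : 0 ≤ sigmaMin M :=
  LinearMap.singularValues_nonneg _ _

theorem sigmaMin_pos (hd : 0 < d) {M : Matrix (Fin d) (Fin d) ℝ} (h : M.PosDef) :
    0 < sigmaMin M := by
  have : Function.Injective (Matrix.toEuclideanLin M) := by
    intro x y hxy
    have h1 : M *ᵥ x.ofLp = M *ᵥ y.ofLp := congrArg WithLp.ofLp hxy
    have := Matrix.mulVec_injective_iff_isUnit.2 h.isUnit h1
    exact WithLp.ofLp_injective 2 this
  refine (LinearMap.injective_iff_forall_lt_finrank_singularValues_pos _).1 this _ ?_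
  simp; omega

/-- A positive singular value has index below the rank, hence below `d`. This rules out dimension
zero, where the index `d - 1` truncates to `0`. -/
theorem pos_of_sigmaMin_pos {M : Matrix (Fin d) (Fin d) ℝ} (h : 0 < sigmaMin M) : 0 < d := by
  rw [sigmaMin, LinearMap.singularValues_pos_iff_lt_finrank_range] at h
  have := (Matrix.toEuclideanLin M).range.finrank_le
  simp at this; omega

/-- Each eigenvalue `e i` of `M` is one of its singular values, since `e i ^ 2` is an eigenvalue of
`MᵀM`; the value at the last index `d - 1` is the least of them. -/
theorem sigmaMin_smul_one_le {M : Matrix (Fin d) (Fin d) ℝ} (h : 0 ≤ M) :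
    sigmaMin M • (1 : Matrix (Fin d) (Fin d) ℝ) ≤ M := by
  obtain ⟨U, e, h1, h2, hM⟩ := exists_orthogonal_diagonal (transpose_eq_of_nonneg h)
  have he : ∀ i, 0 ≤ e i := by rw [← nonneg_conj_diagonal_iff h1 h2, ← hM]; exact h
  have hMt := transpose_eq_of_nonneg h
  rw [hM, smul_one_le_iff h1 h2, ← hM]
  intro i
  set T := Matrix.toEuclideanLin M with hT
  have hTs : LinearMap.adjoint T = T := by
    rw [hT, ← Matrix.toEuclideanLin_conjTranspose_eq_adjoint,
      Matrix.conjTranspose_eq_transpose_of_trivial, hMt]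
  set v : Vec d := WithLp.toLp 2 (U *ᵥ Pi.single i 1) with hv
  have hMU : M * U = U * Matrix.diagonal e := by rw [hM, Matrix.mul_assoc, h1, Matrix.mul_one]
  have hTv : T v = e i • v := by
    rw [hT, hv]
    rw [Matrix.toLpLin_toLp, ← WithLp.toLp_smul, Matrix.toLin'_apply, Matrix.mulVec_mulVec, hMU,
      ← Matrix.mulVec_mulVec, Matrix.diagonal_mulVec_single]
    simp
  have hv0 : v ≠ 0 := by
    intro h0
    have h3 : U *ᵥ Pi.single i 1 = 0 := by simpa [hv] using h0
    have h4 : Uᵀ *ᵥ (U *ᵥ Pi.single i 1) = Pi.single i (1 : ℝ) := by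
      rw [Matrix.mulVec_mulVec, h1, Matrix.one_mulVec]
    rw [h3, Matrix.mulVec_zero] at h4
    simpa using congrFun h4 i
  have hev : Module.End.HasEigenvalue (LinearMap.adjoint T ∘ₗ T) (e i ^ 2) := by
    refine Module.End.hasEigenvalue_of_hasEigenvector (x := v) ⟨?_, hv0⟩
    rw [Module.End.mem_eigenspace_iff, LinearMap.comp_apply, hTs, hTv, map_smul, hTv, smul_smul, sq]
  have hfr : Module.finrank ℝ (Vec d) = d := by simp
  obtain ⟨j, hj⟩ := T.isSymmetric_adjoint_comp_self.exists_eigenvalues_eq hfr hev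
  have h5 := T.sq_singularValues_fin hfr j
  have h6 : T.singularValues (d - 1) ≤ T.singularValues j :=
    T.singularValues_antitone (by omega)
  have h7 : T.singularValues j = e i := by
    have : T.singularValues j ^ 2 = e i ^ 2 := by rw [h5]; exact_mod_cast hj
    exact (pow_left_inj₀ (T.singularValues_nonneg _) (he i) two_ne_zero).1 this
  rw [← h7]; exact h6

end SingularValue

end LQC

namespace LQC

/-! ### Discounted Lyapunov series and second-moment recursions. -/

section Lyapunov

open Filter Topology

variable {n : ℕ}

theorem isClosed_nonneg_matrix : IsClosed {M : Matrix (Fin n) (Fin n) ℝ | 0 ≤ M} := by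
  have : {M : Matrix (Fin n) (Fin n) ℝ | 0 ≤ M} =
      {M | Mᵀ = M} ∩ ⋂ x, {M | 0 ≤ x ⬝ᵥ M *ᵥ x} := by
    ext M; simp [nonneg_iff_quadratic]
  rw [this]
  refine (isClosed_eq (by fun_prop) (by fun_prop)).inter (isClosed_iInter fun x => ?_)
  exact isClosed_le continuous_const (by fun_prop)

theorem hasSum_matrix_le {N : ℕ → Matrix (Fin n) (Fin n) ℝ} {P P' : Matrix (Fin n) (Fin n) ℝ}
    (h : HasSum N P) (hle : ∀ᶠ T in atTop, ∑ t ∈ Finset.range T, N t ≤ P') : P ≤ P' := by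
  have h1 : Tendsto (fun T => P' - ∑ t ∈ Finset.range T, N t) atTop (𝓝 (P' - P)) :=
    h.tendsto_sum_nat.const_sub _
  refine sub_nonneg.1 (isClosed_nonneg_matrix.mem_of_tendsto h1 ?_)
  filter_upwards [hle] with T hT using sub_nonneg.2 hT

theorem hasSum_matrix_nonneg {N : ℕ → Matrix (Fin n) (Fin n) ℝ} {P : Matrix (Fin n) (Fin n) ℝ}
    (h : HasSum N P) (hN : ∀ t, 0 ≤ N t) : 0 ≤ P :=
  isClosed_nonneg_matrix.mem_of_tendsto h.tendsto_sum_nat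
    (Eventually.of_forall fun _ => Finset.sum_nonneg fun t _ => hN t)

theorem summable_matrix_iff {N : ℕ → Matrix (Fin n) (Fin n) ℝ} :
    Summable N ↔ ∀ i j, Summable fun t => N t i j :=
  Pi.summable.trans (forall_congr' fun _ => Pi.summable)

theorem summable_of_summable_trace {N : ℕ → Matrix (Fin n) (Fin n) ℝ} (hN : ∀ t, 0 ≤ N t)
    (h : Summable fun t => (N t).trace) : Summable N :=
  summable_matrix_iff.2 fun i j =>
    Summable.of_norm_bounded h fun t => abs_apply_le_trace (hN t) i j

theorem hasSum_trace_mul {N : ℕ → Matrix (Fin n) (Fin n) ℝ} {S : Matrix (Fin n) (Fin n) ℝ}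
    (h : HasSum N S) (M : Matrix (Fin n) (Fin n) ℝ) :
    HasSum (fun t => (M * N t).trace) (M * S).trace :=
  (h.mul_left M).map (Matrix.traceAddMonoidHom (Fin n) ℝ) (by
    change Continuous fun M : Matrix (Fin n) (Fin n) ℝ => M.trace
    fun_prop)

/-- The terms of the series `∑ γᵗ (Fᵀ)ᵗ M Fᵗ`. -/
def lyapTerm (γ : ℝ) (F M : Matrix (Fin n) (Fin n) ℝ) (t : ℕ) : Matrix (Fin n) (Fin n) ℝ :=
  γ ^ t • ((Fᵀ) ^ t * M * F ^ t)

variable {γ : ℝ} {F M : Matrix (Fin n) (Fin n) ℝ}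

theorem lyapTerm_nonneg (hγ : 0 ≤ γ) (hM : 0 ≤ M) (t : ℕ) : 0 ≤ lyapTerm γ F M t := by
  rw [lyapTerm, ← Matrix.transpose_pow]
  exact smul_matrix_nonneg (conj_nonneg hM _) (pow_nonneg hγ t)

/-- Conjugating the supersolution inequality by `F^(T+1)` trades the remainder for one more term and
a later remainder. The sharper bound `P'` is spent only at the first step; afterwards `P' ≤ P`
suffices. -/
theorem sum_lyapTerm_add_le (hγ : 0 ≤ γ) {P P' : Matrix (Fin n) (Fin n) ℝ}
    (h : M + γ • (Fᵀ * P * F) ≤ P') (hP : P' ≤ P) (T : ℕ) :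
    ∑ t ∈ Finset.range (T + 1), lyapTerm γ F M t + lyapTerm γ F P (T + 1) ≤ P' := by
  induction T with
  | zero => simpa [lyapTerm] using h
  | succ T ih =>
    rw [Finset.sum_range_succ, add_assoc]
    refine le_trans (add_le_add le_rfl ?_) ih
    have h1 := smul_matrix_le (conj_le (h.trans hP) (F ^ (T + 1))) (pow_nonneg hγ (T + 1))
    refine le_trans (le_of_eq ?_) (h1.trans (le_of_eq ?_))
    · rw [lyapTerm, lyapTerm, Matrix.transpose_pow, pow_succ γ (T + 1), mul_smul,
        pow_succ' F (T + 1), pow_succ Fᵀ (T + 1)]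
      simp only [Matrix.mul_add, Matrix.add_mul, smul_add, Matrix.mul_smul, Matrix.smul_mul,
        Matrix.mul_assoc]
    · rw [lyapTerm, Matrix.transpose_pow]

/-- A supersolution certifies convergence by itself, with no spectral radius argument, and the sum
inherits the improved bound `P'`. -/
theorem summable_lyapTerm_of_le (hγ : 0 ≤ γ) (hM : 0 ≤ M) {P P' : Matrix (Fin n) (Fin n) ℝ}
    (hP0 : 0 ≤ P) (h : M + γ • (Fᵀ * P * F) ≤ P') (hP : P' ≤ P) :
    Summable (lyapTerm γ F M) ∧ ∑' t, lyapTerm γ F M t ≤ P' := by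
  have hle : ∀ T, ∑ t ∈ Finset.range (T + 1), lyapTerm γ F M t ≤ P' := fun T =>
    (le_add_of_nonneg_right (lyapTerm_nonneg hγ hP0 _)).trans (sum_lyapTerm_add_le hγ h hP T)
  have hs : Summable (lyapTerm γ F M) := by
    refine summable_of_summable_trace (lyapTerm_nonneg hγ hM) ?_
    refine summable_of_sum_range_le (c := P'.trace)
      (fun t => trace_nonneg_of_nonneg (lyapTerm_nonneg hγ hM t)) fun T => ?_
    rw [← Matrix.trace_sum]
    have h1 : ∑ t ∈ Finset.range T, lyapTerm γ F M t ≤ P' :=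
      le_trans (Finset.sum_le_sum_of_subset_of_nonneg
        (Finset.range_mono (Nat.le_succ T)) fun i _ _ => lyapTerm_nonneg hγ hM i) (hle T)
    have := trace_nonneg_of_nonneg (sub_nonneg.2 h1)
    rw [Matrix.trace_sub] at this
    linarith
  refine ⟨hs, hasSum_matrix_le hs.hasSum ?_⟩
  filter_upwards [eventually_ge_atTop 1] with T hT
  obtain ⟨T, rfl⟩ := Nat.exists_eq_add_of_le' hT
  exact hle T

/-- A sequence of second moment matrices of a linear recursion `x ↦ F x + v`. -/
structure IsMomentSeq (F V : Matrix (Fin n) (Fin n) ℝ) (X : ℕ → Matrix (Fin n) (Fin n) ℝ) :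
    Prop where
  zero_nonneg : 0 ≤ X 0
  noise_nonneg : 0 ≤ V
  succ : ∀ t, X (t + 1) = F * X t * Fᵀ + V

variable {V : Matrix (Fin n) (Fin n) ℝ} {X : ℕ → Matrix (Fin n) (Fin n) ℝ}

theorem IsMomentSeq.nonneg (h : IsMomentSeq F V X) (t : ℕ) : 0 ≤ X t := by
  induction t with
  | zero => exact h.zero_nonneg
  | succ t ih => rw [h.succ]; exact add_nonneg (conj_nonneg' ih F) h.noise_nonneg

theorem IsMomentSeq.pow_conj_le (h : IsMomentSeq F V X) (T t : ℕ) :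
    F ^ t * X T * (F ^ t)ᵀ ≤ X (T + t) := by
  induction t with
  | zero => simp
  | succ t ih =>
    rw [← add_assoc, h.succ]
    refine le_trans (le_trans (le_of_eq ?_) (conj_le' ih F))
      (le_add_of_nonneg_right h.noise_nonneg)
    rw [pow_succ', Matrix.transpose_mul]
    simp only [Matrix.mul_assoc]

theorem IsMomentSeq.trace_lyapTerm_le (h : IsMomentSeq F V X) (hγ : 0 ≤ γ) (hM : 0 ≤ M)
    (T t : ℕ) : (lyapTerm γ F M t * X T).trace ≤ γ ^ t * (M * X (T + t)).trace := by
  have h1 := trace_mul_le' hM (h.pow_conj_le T t)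
  have h2 : (lyapTerm γ F M t * X T).trace = γ ^ t * (M * (F ^ t * X T * (F ^ t)ᵀ)).trace := by
    rw [lyapTerm, Matrix.smul_mul, Matrix.trace_smul, smul_eq_mul, Matrix.transpose_pow]
    congr 1
    rw [← Matrix.mul_assoc, Matrix.trace_mul_comm _ ((Fᵀ) ^ t)]
    simp only [Matrix.mul_assoc]
  rw [h2]
  exact mul_le_mul_of_nonneg_left h1 (pow_nonneg hγ t)

/-- Since `X 0 ⪰ mI`, the trace of the `t`-th term is at most `m⁻¹` times the discounted cost at
time `t`. Hence finite cost implies a finite value matrix. -/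
theorem IsMomentSeq.summable_lyapTerm (h : IsMomentSeq F V X) (hγ : 0 ≤ γ) (hM : 0 ≤ M)
    {m : ℝ} (hm : 0 < m) (hX : m • (1 : Matrix (Fin n) (Fin n) ℝ) ≤ X 0)
    (hs : Summable fun t => γ ^ t * (M * X t).trace) : Summable (lyapTerm γ F M) := by
  refine summable_of_summable_trace (lyapTerm_nonneg hγ hM) ?_
  have h1 : ∀ t, (lyapTerm γ F M t).trace ≤ m⁻¹ * (γ ^ t * (M * X t).trace) := fun t => by
    have h2 := trace_mul_le' (lyapTerm_nonneg hγ hM t) hX (M := lyapTerm γ F M t)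
    have h3 := h.trace_lyapTerm_le hγ hM 0 t
    rw [zero_add] at h3
    rw [Matrix.mul_smul, Matrix.mul_one, Matrix.trace_smul, smul_eq_mul] at h2
    rw [inv_mul_eq_div, le_div_iff₀ hm]
    linarith
  exact Summable.of_nonneg_of_le (fun t => trace_nonneg_of_nonneg (lyapTerm_nonneg hγ hM t)) h1
    (hs.mul_left _)

theorem trace_transpose_conj_mul (F P X : Matrix (Fin n) (Fin n) ℝ) :
    (Fᵀ * P * F * X).trace = (P * (F * X * Fᵀ)).trace := by
  rw [← Matrix.mul_assoc, Matrix.trace_mul_comm (P * (F * X))]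
  simp only [Matrix.mul_assoc]

theorem tsum_lyapTerm_eq (h : Summable (lyapTerm γ F M)) :
    ∑' t, lyapTerm γ F M t = M + γ • (Fᵀ * (∑' t, lyapTerm γ F M t) * F) := by
  have h3 : (fun t : ℕ => lyapTerm γ F M (t + 1)) = fun t : ℕ =>
      γ • (Fᵀ * lyapTerm γ F M t * F) := by
    funext t
    rw [lyapTerm, lyapTerm, pow_succ' γ, pow_succ' (Fᵀ), pow_succ F]
    simp only [Matrix.mul_smul, Matrix.smul_mul, smul_smul, Matrix.mul_assoc]
  have h4 : HasSum (fun t : ℕ => γ • (Fᵀ * lyapTerm γ F M t * F))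
      (γ • (Fᵀ * (∑' t, lyapTerm γ F M t) * F)) :=
    ((h.hasSum.mul_left _).mul_right _).const_smul _
  conv_lhs => rw [h.tsum_eq_zero_add, h3, h4.tsum_eq]
  simp [lyapTerm]

/-- The equation `P = M + γFᵀPF` makes the discounted costs telescope, each step leaving the noise
contribution `γ tr(PV)`. Convergence of the series for `P` replaces any stability assumption on `F`.
-/
theorem IsMomentSeq.hasSum_trace (h : IsMomentSeq F V X) (hγ : 0 ≤ γ) (hγ1 : γ < 1) (hM : 0 ≤ M)
    (hs : Summable (lyapTerm γ F M)) :
    HasSum (fun t => γ ^ t * (M * X t).trace)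
      (((∑' t, lyapTerm γ F M t) * X 0).trace +
        γ / (1 - γ) * ((∑' t, lyapTerm γ F M t) * V).trace) := by
  set P := ∑' t, lyapTerm γ F M t with hP
  have hP0 : 0 ≤ P := hasSum_matrix_nonneg hs.hasSum (lyapTerm_nonneg hγ hM)
  have hPeq : P = M + γ • (Fᵀ * P * F) := tsum_lyapTerm_eq hs
  have hstep : ∀ t, (M * X t).trace =
      (P * X t).trace - γ * (P * X (t + 1)).trace + γ * (P * V).trace := fun t => by
    have : (P * X t).trace = (M * X t).trace + γ * (P * (F * X t * Fᵀ)).trace := by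
      conv_lhs => rw [hPeq]
      rw [Matrix.add_mul, Matrix.trace_add, Matrix.smul_mul, Matrix.trace_smul,
        trace_transpose_conj_mul, smul_eq_mul]
    rw [this, h.succ, Matrix.mul_add, Matrix.trace_add]
    ring
  have hpart : ∀ T, ∑ t ∈ Finset.range T, γ ^ t * (M * X t).trace =
      (P * X 0).trace - γ ^ T * (P * X T).trace +
        (∑ t ∈ Finset.range T, γ ^ t) * (γ * (P * V).trace) := fun T => by
    induction T with
    | zero => simp
    | succ T ih => rw [Finset.sum_range_succ, ih, Finset.sum_range_succ, hstep, pow_succ]; ring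
  have hnn : ∀ t, 0 ≤ γ ^ t * (M * X t).trace := fun t =>
    mul_nonneg (pow_nonneg hγ t) (trace_mul_nonneg hM (h.nonneg t))
  have hgeo := hasSum_geometric_of_lt_one hγ hγ1
  have hPV : 0 ≤ γ * (P * V).trace := mul_nonneg hγ (trace_mul_nonneg hP0 h.noise_nonneg)
  have hsum : Summable fun t => γ ^ t * (M * X t).trace := by
    refine summable_of_sum_range_le (c := (P * X 0).trace + (1 - γ)⁻¹ * (γ * (P * V).trace))
      hnn fun T => ?_
    rw [hpart]
    have h1 : ∑ t ∈ Finset.range T, γ ^ t ≤ (1 - γ)⁻¹ :=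
      sum_le_hasSum _ (fun t _ => pow_nonneg hγ t) hgeo
    have h2 := mul_nonneg (pow_nonneg hγ T) (trace_mul_nonneg hP0 (h.nonneg T))
    have := mul_le_mul_of_nonneg_right h1 hPV
    linarith
  -- `γ^T tr(P X_T)` is the cost-to-go without later noise, hence at most the tail of the cost
  -- series, already known to converge.
  have htail : Tendsto (fun T => γ ^ T * (P * X T).trace) atTop (𝓝 0) := by
    refine squeeze_zero (fun T => mul_nonneg (pow_nonneg hγ T)
      (trace_mul_nonneg hP0 (h.nonneg T))) (fun T => ?_)
      (tendsto_sum_nat_add fun t => γ ^ t * (M * X t).trace)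
    have h1 : HasSum (fun t => (lyapTerm γ F M t * X T).trace) (P * X T).trace := by
      simpa only [Matrix.trace_mul_comm (X T)] using hasSum_trace_mul hs.hasSum (X T)
    refine hasSum_le (fun t => ?_) (h1.mul_left (γ ^ T)) ((summable_nat_add_iff T).2 hsum).hasSum
    have h2 := mul_le_mul_of_nonneg_left (h.trace_lyapTerm_le hγ hM T t) (pow_nonneg hγ T)
    refine h2.trans (le_of_eq ?_)
    rw [pow_add, add_comm T t]; ring
  refine (hsum.hasSum_iff_tendsto_nat).2 ?_
  simp only [hpart]
  have := (htail.const_sub (P * X 0).trace).add (hgeo.tendsto_sum_nat.mul_const (γ * (P * V).trace))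
  convert this using 2
  rw [sub_zero]; ring

/-- Discounted moments are summable under a contraction. -/
theorem IsMomentSeq.summable_smul (h : IsMomentSeq F V X) (hγ : 0 ≤ γ) (hγ1 : γ < 1) {q : ℝ}
    (hF : Fᵀ * F ≤ q • (1 : Matrix (Fin n) (Fin n) ℝ)) (hq : γ * q < 1) :
    Summable fun t => γ ^ t • X t := by
  refine summable_of_summable_trace (fun t => smul_matrix_nonneg (h.nonneg t) (pow_nonneg hγ t)) ?_
  simp only [Matrix.trace_smul, smul_eq_mul]
  have hX := fun t => trace_nonneg_of_nonneg (h.nonneg t)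
  have hV := trace_nonneg_of_nonneg h.noise_nonneg
  have hstep : ∀ t, (X (t + 1)).trace ≤ q * (X t).trace + V.trace := fun t => by
    have h1 := trace_mul_le hF (h.nonneg t)
    have h2 := trace_transpose_conj_mul F 1 (X t)
    simp only [Matrix.mul_one, Matrix.one_mul, Matrix.smul_mul, Matrix.trace_smul, smul_eq_mul]
      at h1 h2
    rw [h.succ, Matrix.trace_add]
    linarith
  have hnn : ∀ t, 0 ≤ γ ^ t * (X t).trace := fun t => mul_nonneg (pow_nonneg hγ t) (hX t)
  have hgeo := hasSum_geometric_of_lt_one hγ hγ1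
  refine summable_of_sum_range_le
    (c := ((X 0).trace + (1 - γ)⁻¹ * (γ * V.trace)) / (1 - γ * q)) hnn fun T => ?_
  -- The partial sums satisfy `s_{T+1} ≤ c + γq·s_T`; together with `s_T ≤ s_{T+1}` and `γq < 1`
  -- this bounds them uniformly.
  have hrec : ∀ T, ∑ t ∈ Finset.range (T + 1), γ ^ t * (X t).trace ≤
      (X 0).trace + γ * q * ∑ t ∈ Finset.range T, γ ^ t * (X t).trace +
        (∑ t ∈ Finset.range T, γ ^ t) * (γ * V.trace) := fun T => by
    rw [Finset.sum_range_succ', Finset.mul_sum, Finset.sum_mul]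
    have : ∑ t ∈ Finset.range T, γ ^ (t + 1) * (X (t + 1)).trace ≤
        ∑ t ∈ Finset.range T, (γ * q * (γ ^ t * (X t).trace) + γ ^ t * (γ * V.trace)) := by
      refine Finset.sum_le_sum fun t _ => ?_
      refine (mul_le_mul_of_nonneg_left (hstep t) (pow_nonneg hγ (t + 1))).trans (le_of_eq ?_)
      rw [pow_succ]; ring
    rw [Finset.sum_add_distrib] at this
    simp only [pow_zero, one_mul]
    linarith
  have hgeoT : ∑ t ∈ Finset.range T, γ ^ t ≤ (1 - γ)⁻¹ :=
    sum_le_hasSum _ (fun t _ => pow_nonneg hγ t) hgeo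
  have h1 := mul_le_mul_of_nonneg_right hgeoT (mul_nonneg hγ hV)
  have h2 := hrec T
  have h3 : ∑ t ∈ Finset.range T, γ ^ t * (X t).trace ≤
      ∑ t ∈ Finset.range (T + 1), γ ^ t * (X t).trace := by
    rw [Finset.sum_range_succ]; linarith [hnn T]
  rw [le_div_iff₀ (by linarith)]
  linarith

theorem IsMomentSeq.tsum_eq (h : IsMomentSeq F V X) (hγ : 0 ≤ γ) (hγ1 : γ < 1)
    (hs : Summable fun t => γ ^ t • X t) :
    ∑' t, γ ^ t • X t = X 0 + γ • (F * (∑' t, γ ^ t • X t) * Fᵀ) + (γ / (1 - γ)) • V := by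
  have h3 : (fun t : ℕ => γ ^ (t + 1) • X (t + 1)) = fun t : ℕ =>
      γ • (F * (γ ^ t • X t) * Fᵀ) + γ ^ t • (γ • V) := by
    funext t
    rw [h.succ, pow_succ']
    simp only [Matrix.mul_smul, Matrix.smul_mul, smul_smul, smul_add, mul_comm]
  have h4 : HasSum (fun t : ℕ => γ • (F * (γ ^ t • X t) * Fᵀ))
      (γ • (F * (∑' t, γ ^ t • X t) * Fᵀ)) :=
    ((hs.hasSum.mul_left _).mul_right _).const_smul _
  have h5 := (hasSum_geometric_of_lt_one hγ hγ1).smul_const (γ • V)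
  conv_lhs => rw [hs.tsum_eq_zero_add, h3, (h4.add h5).tsum_eq]
  simp only [pow_zero, one_smul, smul_smul]
  rw [← add_assoc, inv_mul_eq_div]

/-- Discounted cost of one gain, expressed through the Bellman residual of another value matrix. -/
theorem IsMomentSeq.hasSum_trace_residual (h : IsMomentSeq F V X) (hγ : 0 ≤ γ) (hγ1 : γ < 1)
    (hs : Summable fun t => γ ^ t • X t) (P : Matrix (Fin n) (Fin n) ℝ) :
    HasSum (fun t => γ ^ t * (M * X t).trace)
      ((P * X 0).trace + γ / (1 - γ) * (P * V).trace +
        ((M + γ • (Fᵀ * P * F) - P) * ∑' t, γ ^ t • X t).trace) := by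
  have h1 := hasSum_trace_mul hs.hasSum M
  simp only [Matrix.mul_smul, Matrix.trace_smul, smul_eq_mul] at h1
  convert h1 using 1
  -- Pairing the fixed-point equation of the discounted moment sum with an arbitrary `P` suffices:
  -- `P` itself need solve no equation.
  have h2 := congrArg (fun S => (P * S).trace) (h.tsum_eq hγ hγ1 hs)
  simp only [Matrix.mul_add, Matrix.trace_add, Matrix.mul_smul, Matrix.trace_smul,
    smul_eq_mul] at h2
  rw [Matrix.sub_mul, Matrix.add_mul, Matrix.trace_sub, Matrix.trace_add, Matrix.smul_mul,
    Matrix.trace_smul, trace_transpose_conj_mul, smul_eq_mul, h2]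
  ring

end Lyapunov

end LQC

namespace LQC

/-! ### The Bellman operator under a change of gain. -/

section GainUpdate

variable {n k : ℕ} {A Q P : Matrix (Fin n) (Fin n) ℝ} {B : Matrix (Fin n) (Fin k) ℝ}
  {R : Matrix (Fin k) (Fin k) ℝ}

/-- Exact Taylor expansion in the gain. It serves twice: with `D` the gradient step, and with `D`
the displacement to the comparison gain. -/
theorem bellman_add_eq (hP : Pᵀ = P) (hR : Rᵀ = R) (γ : ℝ) (K D : Matrix (Fin k) (Fin n) ℝ) :
    Q + (K + D)ᵀ * R * (K + D) + γ • ((A - B * (K + D))ᵀ * P * (A - B * (K + D))) =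
      Q + Kᵀ * R * K + γ • ((A - B * K)ᵀ * P * (A - B * K)) +
        (Dᵀ * (R + γ • (Bᵀ * P * B)) * D +
          Dᵀ * (-(γ • (Bᵀ * P * (A - B * K))) + R * K) +
          (-(γ • (Bᵀ * P * (A - B * K))) + R * K)ᵀ * D) := by
  have hF : A - B * (K + D) = (A - B * K) - B * D := by rw [Matrix.mul_add]; abel
  rw [hF]
  generalize A - B * K = F
  simp only [Matrix.transpose_add, Matrix.transpose_sub, Matrix.transpose_neg,
    Matrix.transpose_smul, Matrix.transpose_mul, Matrix.transpose_transpose, hP, hR,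
    Matrix.mul_add, Matrix.add_mul, Matrix.mul_sub, Matrix.sub_mul, Matrix.mul_neg, Matrix.neg_mul,
    Matrix.mul_smul, Matrix.smul_mul, smul_sub, Matrix.mul_assoc]
  abel

/-- The two linear terms contribute `-2r⁻¹EᵀE`, and `G ⪯ rI` lets the quadratic term give back at
most `r⁻¹EᵀE`. -/
theorem gradient_step_le {G : Matrix (Fin k) (Fin k) ℝ} {r : ℝ} (hr : 0 < r)
    (hG : G ≤ r • (1 : Matrix (Fin k) (Fin k) ℝ)) (E : Matrix (Fin k) (Fin n) ℝ) :
    (-(r⁻¹ • E))ᵀ * G * (-(r⁻¹ • E)) + (-(r⁻¹ • E))ᵀ * E + Eᵀ * (-(r⁻¹ • E)) ≤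
      -(r⁻¹ • (Eᵀ * E)) := by
  have h1 := smul_matrix_le (conj_le hG E) (by positivity : 0 ≤ r⁻¹ * r⁻¹)
  have h2 : (r⁻¹ * r⁻¹) • (Eᵀ * (r • (1 : Matrix (Fin k) (Fin k) ℝ)) * E) = r⁻¹ • (Eᵀ * E) := by
    rw [Matrix.mul_smul, Matrix.smul_mul, smul_smul, Matrix.mul_one]
    congr 1; field_simp
  have h3 : (-(r⁻¹ • E))ᵀ * G * (-(r⁻¹ • E)) + (-(r⁻¹ • E))ᵀ * E + Eᵀ * (-(r⁻¹ • E)) =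
      (r⁻¹ * r⁻¹) • (Eᵀ * G * E) - r⁻¹ • (Eᵀ * E) - r⁻¹ • (Eᵀ * E) := by
    simp only [Matrix.transpose_neg, Matrix.transpose_smul, Matrix.mul_neg, Matrix.neg_mul,
      Matrix.mul_smul, Matrix.smul_mul]
    module
  rw [h3]
  rw [h2] at h1
  calc _ ≤ r⁻¹ • (Eᵀ * E) - r⁻¹ • (Eᵀ * E) - r⁻¹ • (Eᵀ * E) := by gcongr
    _ = _ := by abel

/-- Completing the square: `s⁻¹(sD+E)ᵀ(sD+E) ⪰ 0`. -/
theorem residual_ge {G : Matrix (Fin k) (Fin k) ℝ} {s : ℝ} (hs : 0 < s)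
    (hG : s • (1 : Matrix (Fin k) (Fin k) ℝ) ≤ G) (E D : Matrix (Fin k) (Fin n) ℝ) :
    -(s⁻¹ • (Eᵀ * E)) ≤ Dᵀ * G * D + Dᵀ * E + Eᵀ * D := by
  have h1 := conj_le hG D
  have h2 := smul_matrix_nonneg (transpose_mul_self_nonneg (s • D + E)) (inv_pos.2 hs).le
  have h3 : s⁻¹ • ((s • D + E)ᵀ * (s • D + E)) =
      Dᵀ * (s • (1 : Matrix (Fin k) (Fin k) ℝ)) * D + Dᵀ * E + Eᵀ * D + s⁻¹ • (Eᵀ * E) := by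
    simp only [Matrix.transpose_add, Matrix.transpose_smul, Matrix.mul_add, Matrix.add_mul,
      Matrix.mul_smul, Matrix.smul_mul, smul_smul, smul_add, Matrix.mul_one]
    rw [inv_mul_cancel₀ hs.ne', inv_mul_cancel_left₀ hs.ne', one_smul, one_smul]
    abel
  rw [h3] at h2
  calc -(s⁻¹ • (Eᵀ * E)) ≤ Dᵀ * (s • (1 : Matrix (Fin k) (Fin k) ℝ)) * D + Dᵀ * E + Eᵀ * D :=
      neg_le_iff_add_nonneg.2 h2
    _ ≤ _ := by gcongr

end GainUpdate

/-! ### The covariance update for a fixed Hessian. -/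

section CovarianceUpdate

theorem neg_log_one_sub_le {z : ℝ} (hz : 0 ≤ z) (hz1 : z < 1) :
    -Real.log (1 - z) ≤ z + z ^ 2 / (2 * (1 - z)) := by
  have h1 : 0 < 1 - z := by linarith
  have h2 : 0 ≤ -Real.log (1 - z) := by
    have := Real.log_nonpos h1.le (by linarith); linarith
  -- At `x = -log(1-z)`, `sinh x` equals the right-hand side exactly, so the claim is `x ≤ sinh x`.
  have h3 := Real.self_le_sinh_iff.2 h2
  rw [← Real.log_inv, Real.sinh_log (by positivity), inv_inv] at h3
  rw [← Real.log_inv]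
  refine h3.trans (le_of_eq ?_)
  field_simp
  ring

/-- Here `v` stands for an eigenvalue of `(2/τ)√Σ G √Σ`: the step scales its direction by `1 -
a²(v-1)`, and `v - 1 - log v` is its share of the gap. Both sides are compared with `-a²(v-1)²/2`.
-/
theorem covariance_scalar_decrease {a b v : ℝ} (ha : 0 < a) (ha1 : a ≤ 1) (hb : 0 < b)
    (hbv : b ≤ v) (hva : v ≤ a⁻¹) :
    0 < 1 - a ^ 2 * (v - 1) ∧
      -(a ^ 2 * (v * (v - 1))) - Real.log (1 - a ^ 2 * (v - 1)) ≤
        -(a ^ 2 * b / 2 * (v - 1 - Real.log v)) := by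
  have hv : 0 < v := hb.trans_le hbv
  have hav : a * v ≤ 1 := by
    calc a * v ≤ a * a⁻¹ := by gcongr
      _ = 1 := mul_inv_cancel₀ ha.ne'
  have h1 : a ^ 2 * (v - 1) ≤ a - a ^ 2 := by nlinarith
  have hpos : 0 < 1 - a ^ 2 * (v - 1) := by nlinarith
  refine ⟨hpos, ?_⟩
  have hright : b * (v - 1 - Real.log v) ≤ (v - 1) ^ 2 := by
    have h2 := Real.one_sub_inv_le_log_of_pos hv
    have h3 : v - 1 - Real.log v ≤ (v - 1) ^ 2 / v := by
      calc v - 1 - Real.log v ≤ v - 1 - (1 - v⁻¹) := by linarith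
        _ = _ := by field_simp
    have h4 : 0 ≤ v - 1 - Real.log v := by linarith [Real.log_le_sub_one_of_pos hv]
    calc b * (v - 1 - Real.log v) ≤ v * (v - 1 - Real.log v) := by gcongr
      _ ≤ v * ((v - 1) ^ 2 / v) := by gcongr
      _ = _ := by field_simp
  have hleft : -Real.log (1 - a ^ 2 * (v - 1)) ≤
      a ^ 2 * (v - 1) + a ^ 2 * (v - 1) ^ 2 / 2 := by
    rcases le_total 1 v with h | h
    · have h2 : 0 ≤ a ^ 2 * (v - 1) := mul_nonneg (by positivity) (by linarith)
      refine (neg_log_one_sub_le h2 (by linarith)).trans ?_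
      refine add_le_add le_rfl ?_
      rw [div_le_div_iff₀ (by linarith) two_pos]
      -- This says `a²v ≤ 1`, which follows from `av ≤ 1` and `a ≤ 1`.
      have h3 : a ^ 2 ≤ 1 - a ^ 2 * (v - 1) := by nlinarith
      have h4 : 0 ≤ a ^ 2 * (v - 1) ^ 2 := by positivity
      nlinarith [mul_le_mul_of_nonneg_left h3 h4]
    · have h2 : 0 ≤ a ^ 2 * (1 - v) := mul_nonneg (by positivity) (by linarith)
      have h3 := Real.le_log_one_add_of_nonneg h2
      have h4 : a ^ 2 * (1 - v) - (a ^ 2 * (1 - v)) ^ 2 / 2 ≤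
          2 * (a ^ 2 * (1 - v)) / (a ^ 2 * (1 - v) + 2) := by
        rw [le_div_iff₀ (by linarith)]
        nlinarith [pow_nonneg h2 3]
      have h5 : 1 - a ^ 2 * (v - 1) = 1 + a ^ 2 * (1 - v) := by ring
      rw [h5]
      have h6 : a ^ 2 * a ^ 2 ≤ a ^ 2 * 1 := by gcongr; nlinarith
      nlinarith [mul_le_mul_of_nonneg_right h6 (sq_nonneg (v - 1))]
  have := mul_le_mul_of_nonneg_left hright (by positivity : 0 ≤ a ^ 2 / 2)
  nlinarith

variable {ι : Type*} [Fintype ι] [DecidableEq ι]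

theorem commute_mul_nonneg {M N : Matrix ι ι ℝ} (hM : 0 ≤ M) (hN : 0 ≤ N) (h : M * N = N * M) :
    0 ≤ M * N := by
  exact Commute.mul_nonneg hM hN h

/-- The covariance part of the cost, up to a constant. -/
noncomputable def covObjective (τ : ℝ) (G S : Matrix ι ι ℝ) : ℝ :=
  (G * S).trace - τ / 2 * Real.log S.det

/-- The covariance update. -/
noncomputable def covStep (τ c : ℝ) (G S : Matrix ι ι ℝ) : Matrix ι ι ℝ :=
  S - c • (S * (G - (τ / 2) • S⁻¹) * S)

theorem covStep_eq {τ c : ℝ} {G S : Matrix ι ι ℝ} (hS : S.PosDef) :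
    covStep τ c G S = S + (c * (τ / 2)) • S - c • (S * G * S) := by
  have h1 : S⁻¹ * S = 1 := Matrix.nonsing_inv_mul _ hS.det_pos.ne'.isUnit
  have h2 : S * S⁻¹ = 1 := Matrix.mul_nonsing_inv _ hS.det_pos.ne'.isUnit
  rw [covStep, Matrix.mul_sub, Matrix.sub_mul, Matrix.mul_smul, h2, Matrix.smul_mul,
    Matrix.one_mul, smul_sub, smul_smul]
  abel

variable {τ r a s : ℝ} {G S : Matrix ι ι ℝ}

/-- With `c = τ/(2r²)` one has `cr = a` and `cτ/2 = a²`. The bound `G ⪯ rI` gives `S' ⪰ aI +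
(S-a)(1-aS)`, and `G ⪰ (τ/2)I` gives `S' ⪯ I - (1-S)(1-a²S)`; both products have commuting positive
semidefinite factors. -/
theorem covStep_mem (hr : 0 < r) (hτ : 0 < τ) (ha : a = τ / (2 * r)) (ha1 : a ≤ 1)
    (hG : (τ / 2) • (1 : Matrix ι ι ℝ) ≤ G) (hG' : G ≤ r • (1 : Matrix ι ι ℝ))
    (hS : a • (1 : Matrix ι ι ℝ) ≤ S) (hS' : S ≤ 1) :
    a • (1 : Matrix ι ι ℝ) ≤ covStep τ (τ / (2 * r ^ 2)) G S ∧
      covStep τ (τ / (2 * r ^ 2)) G S ≤ 1 := by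
  have ha0 : 0 < a := by rw [ha]; positivity
  have hSpd := posDef_of_smul_one_le ha0 hS
  have hSt := transpose_eq_of_nonneg hSpd.posSemidef.nonneg
  rw [covStep_eq hSpd]
  set c := τ / (2 * r ^ 2) with hc
  have hc0 : 0 < c := by rw [hc]; positivity
  have hcr : c * r = a := by rw [hc, ha]; field_simp
  have hcτ : c * (τ / 2) = a ^ 2 := by rw [hc, ha]; field_simp
  rw [hcτ]
  have hu := smul_matrix_le (conj_le hG' S) hc0.le
  have hl := smul_matrix_le (conj_le hG S) hc0.le
  rw [hSt, Matrix.mul_smul, Matrix.smul_mul, smul_smul, Matrix.mul_one] at hu hl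
  rw [hcr] at hu
  rw [hcτ] at hl
  constructor
  · have h0 : 0 ≤ (S - a • 1) * (1 - a • S) := by
      refine commute_mul_nonneg (sub_nonneg.2 hS) ?_ ?_
      · have h1 := smul_matrix_le hS' ha0.le
        have h2 := smul_one_mono (ι := ι) ha1
        rw [one_smul] at h2
        exact sub_nonneg.2 (h1.trans h2)
      · simp only [Matrix.mul_sub, Matrix.sub_mul, Matrix.mul_one, Matrix.one_mul, Matrix.smul_mul,
          Matrix.mul_smul]
        module
    have h1 : (S - a • 1) * (1 - a • S) = S + a ^ 2 • S - a • (S * S) - a • 1 := by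
      simp only [Matrix.mul_sub, Matrix.sub_mul, Matrix.mul_one, Matrix.one_mul, Matrix.smul_mul,
        Matrix.mul_smul, sq]
      module
    rw [h1] at h0
    exact (sub_nonneg.1 h0).trans (sub_le_sub_left hu _)
  · have h0 : 0 ≤ (1 - S) * (1 - a ^ 2 • S) := by
      refine commute_mul_nonneg (sub_nonneg.2 hS') ?_ ?_
      · have h1 := smul_matrix_le hS' (sq_nonneg a)
        have h2 := smul_one_mono (ι := ι) (pow_le_one₀ ha0.le ha1 : a ^ 2 ≤ 1)
        rw [one_smul] at h2
        exact sub_nonneg.2 (h1.trans h2)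
      · simp only [Matrix.mul_sub, Matrix.sub_mul, Matrix.mul_one, Matrix.one_mul, Matrix.smul_mul,
          Matrix.mul_smul]
        module
    have h1 : (1 - S) * (1 - a ^ 2 • S) = 1 - (S + a ^ 2 • S - a ^ 2 • (S * S)) := by
      simp only [Matrix.mul_sub, Matrix.sub_mul, Matrix.mul_one, Matrix.one_mul, Matrix.mul_smul]
      module
    rw [h1] at h0
    exact (sub_le_sub_left hl _).trans (sub_nonneg.1 h0)

/-- Normalized spectral form of the covariance objective at `T * T` around its minimizer. -/
theorem covObjective_sub_le (hτ : 0 < τ) (hG : G.PosDef) {S' : Matrix ι ι ℝ} (hS : S.PosDef)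
    (hS' : S'.PosDef) {N : Matrix ι ι ℝ} (hNt : N.trace = 2 / τ * (G * S).trace)
    (hNd : N.det = (2 / τ) ^ Fintype.card ι * (G.det * S.det)) :
    covObjective τ G S - covObjective τ G S' ≤
      τ / 2 * (N.trace - Fintype.card ι - Real.log N.det) := by
  set L := CFC.sqrt G with hL
  have hLL : L * L = G := CFC.sqrt_mul_sqrt_self G hG.posSemidef.nonneg
  have hLt : Lᵀ = L := transpose_eq_of_nonneg (CFC.sqrt_nonneg G)
  have hdetL : L.det ≠ 0 := by
    have := hG.det_pos.ne'
    rw [← hLL, Matrix.det_mul] at this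
    exact (mul_ne_zero_iff.1 this).1
  -- The trace inequality is applied to the normalized competitor `(2/τ)√G S' √G`. The matrix `N`
  -- enters only through its trace and determinant, so any matrix with the right invariants will do.
  have hY : ((2 / τ) • (L * S' * Lᵀ)).PosDef := by
    refine Matrix.PosDef.smul ?_ (by positivity)
    refine (Matrix.nonneg_iff_posSemidef.1
      (conj_nonneg' hS'.posSemidef.nonneg L)).posDef_iff_det_ne_zero.2 ?_
    rw [Matrix.det_mul, Matrix.det_mul, Matrix.det_transpose]
    exact mul_ne_zero (mul_ne_zero hdetL hS'.det_pos.ne') hdetL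
  have h1 := card_add_log_det_le_trace hY
  have htr : ((2 / τ) • (L * S' * Lᵀ)).trace = 2 / τ * (G * S').trace := by
    rw [Matrix.trace_smul, smul_eq_mul, Matrix.trace_mul_comm, ← Matrix.mul_assoc, hLt, hLL]
  have hdet : ((2 / τ) • (L * S' * Lᵀ)).det = (2 / τ) ^ Fintype.card ι * (G.det * S'.det) := by
    rw [Matrix.det_smul, Matrix.det_mul, Matrix.det_mul, Matrix.det_transpose, ← hLL,
      Matrix.det_mul]
    ring
  have hp : 0 < (2 / τ) ^ Fintype.card ι := by positivity
  have hg := hG.det_pos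
  rw [htr, hdet, Real.log_mul hp.ne' (mul_pos hg hS'.det_pos).ne',
    Real.log_mul hg.ne' hS'.det_pos.ne'] at h1
  rw [hNt, hNd, Real.log_mul hp.ne' (mul_pos hg hS.det_pos).ne',
    Real.log_mul hg.ne' hS.det_pos.ne', covObjective, covObjective]
  have h2 := mul_le_mul_of_nonneg_left h1 (by positivity : 0 ≤ τ / 2)
  have h3 : τ / 2 * (2 / τ * (G * S').trace) = (G * S').trace := by field_simp
  have h4 : τ / 2 * (2 / τ * (G * S).trace) = (G * S).trace := by field_simp
  rw [h3] at h2
  simp only [mul_sub, mul_add, h4] at h2 ⊢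
  linarith

/-- In the coordinates of `N = (2/τ)√S G √S` the step is a function of `N`, so diagonalizing `N`
splits the change of objective into scalar terms. The bounds on `G` and `S` place the spectrum of
`N` in `[s/r, 1/a]`. -/
theorem covStep_decrease (hr : 0 < r) (hτ : 0 < τ) (ha : a = τ / (2 * r)) (ha1 : a ≤ 1)
    (hs : 0 < s) (hG : s • (1 : Matrix ι ι ℝ) ≤ G) (hG' : G ≤ r • (1 : Matrix ι ι ℝ))
    (hS : a • (1 : Matrix ι ι ℝ) ≤ S) (hS' : S ≤ 1) {S₁ : Matrix ι ι ℝ} (hS₁ : S₁.PosDef) :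
    covObjective τ G (covStep τ (τ / (2 * r ^ 2)) G S) - covObjective τ G S ≤
      -(a ^ 2 * (s / r) / 2 * (covObjective τ G S - covObjective τ G S₁)) := by
  have ha0 : 0 < a := by rw [ha]; positivity
  have hSpd := posDef_of_smul_one_le ha0 hS
  have hGpd := posDef_of_smul_one_le hs hG
  rw [covStep_eq hSpd]
  set c := τ / (2 * r ^ 2) with hc
  have hcτ : c * (τ / 2) = a ^ 2 := by rw [hc, ha]; field_simp
  rw [hcτ]
  set T := CFC.sqrt S with hT
  have hTT : T * T = S := CFC.sqrt_mul_sqrt_self S hSpd.posSemidef.nonneg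
  have hTt : Tᵀ = T := transpose_eq_of_nonneg (CFC.sqrt_nonneg S)
  set N := (2 / τ) • (T * G * Tᵀ) with hN
  have hNl : (s / r) • (1 : Matrix ι ι ℝ) ≤ N := by
    have h1 := smul_matrix_le (conj_le' hG T) (by positivity : 0 ≤ 2 / τ)
    refine le_trans ?_ h1
    rw [Matrix.mul_smul, Matrix.smul_mul, smul_smul, Matrix.mul_one, hTt, hTT]
    refine le_trans (le_of_eq ?_) (smul_matrix_le hS (by positivity : 0 ≤ 2 / τ * s))
    rw [smul_smul, ha]; congr 1; field_simp
  have hNu : N ≤ a⁻¹ • (1 : Matrix ι ι ℝ) := by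
    have h1 := smul_matrix_le (conj_le' hG' T) (by positivity : 0 ≤ 2 / τ)
    refine le_trans h1 ?_
    rw [Matrix.mul_smul, Matrix.smul_mul, smul_smul, Matrix.mul_one, hTt, hTT]
    refine le_trans (smul_matrix_le hS' (by positivity : 0 ≤ 2 / τ * r)) (le_of_eq ?_)
    rw [ha]; congr 1; field_simp
  have hNt : N.trace = 2 / τ * (G * S).trace := by
    rw [hN, Matrix.trace_smul, smul_eq_mul, Matrix.mul_assoc, Matrix.trace_mul_comm, Matrix.mul_assoc,
      hTt, hTT]
  have hNd : N.det = (2 / τ) ^ Fintype.card ι * (G.det * S.det) := by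
    rw [hN, Matrix.det_smul, Matrix.det_mul, Matrix.det_mul, Matrix.det_transpose, ← hTT,
      Matrix.det_mul]
    ring
  have hgap := covObjective_sub_le hτ hGpd hSpd hS₁ hNt hNd
  have hN0 : 0 ≤ N := smul_matrix_nonneg (conj_nonneg' hGpd.posSemidef.nonneg T) (by positivity)
  obtain ⟨U, d, hU1, hU2, hd⟩ := exists_orthogonal_diagonal (transpose_eq_of_nonneg hN0)
  rw [hd, smul_one_le_iff hU1 hU2] at hNl
  rw [hd, le_smul_one_iff hU1 hU2] at hNu
  have hb : 0 < s / r := by positivity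
  have hsc := fun i => covariance_scalar_decrease ha0 ha1 hb (hNl i) (hNu i)
  have hstep : S + a ^ 2 • S - c • (S * G * S) = T * (1 - a ^ 2 • (N - 1)) * T := by
    have h1 : a ^ 2 • N = c • (T * G * T) := by
      rw [hN, smul_smul, hTt]; congr 1; rw [ha, hc]; field_simp
    have h2 : S * G * S = T * (T * G * T) * T := by rw [← hTT]; simp only [Matrix.mul_assoc]
    rw [smul_sub, h1, h2]
    simp only [Matrix.mul_sub, Matrix.sub_mul, Matrix.mul_one, Matrix.mul_smul, Matrix.smul_mul,
      hTT]
    abel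
  have hI : 1 - a ^ 2 • (N - 1) = U * Matrix.diagonal (fun i => 1 - a ^ 2 * (d i - 1)) * Uᵀ := by
    have h1 : Matrix.diagonal (fun i => 1 - a ^ 2 * (d i - 1)) =
        (1 + a ^ 2) • (1 : Matrix ι ι ℝ) - a ^ 2 • Matrix.diagonal d := by
      rw [smul_one_eq_diagonal, ← Matrix.diagonal_smul, Matrix.diagonal_sub]
      congr 1; funext i; simp; ring
    rw [h1, Matrix.mul_sub, Matrix.sub_mul, Matrix.mul_smul, Matrix.mul_smul, Matrix.smul_mul,
      Matrix.smul_mul, ← hd, Matrix.mul_one, hU2, smul_sub, add_smul, one_smul]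
    abel
  have hNN : N * N = U * Matrix.diagonal (fun i => d i * d i) * Uᵀ := by
    rw [← Matrix.diagonal_mul_diagonal]
    calc N * N = U * Matrix.diagonal d * (Uᵀ * U) * Matrix.diagonal d * Uᵀ := by
          rw [hd]; simp only [Matrix.mul_assoc]
      _ = _ := by rw [hU1]; simp only [Matrix.mul_assoc, Matrix.one_mul]
  have htr : (G * (S + a ^ 2 • S - c • (S * G * S))).trace = (G * S).trace -
      τ / 2 * ∑ i, a ^ 2 * (d i * (d i - 1)) := by
    have h1 : (N * N).trace = (2 / τ) ^ 2 * (G * (S * G * S)).trace := by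
      rw [hN, Matrix.smul_mul, Matrix.mul_smul, smul_smul, Matrix.trace_smul, smul_eq_mul, sq]
      congr 1
      rw [hTt]
      calc (T * G * T * (T * G * T)).trace = (T * (G * (T * T) * G * T)).trace := by
            simp only [Matrix.mul_assoc]
        _ = (G * (T * T) * G * T * T).trace := Matrix.trace_mul_comm _ _
        _ = _ := by rw [hTT, Matrix.mul_assoc _ T T, hTT]; simp only [Matrix.mul_assoc]
    rw [hNN, trace_orthogonal_conj hU1, Matrix.trace_diagonal] at h1
    have h2 := hNt
    rw [hd, trace_orthogonal_conj hU1, Matrix.trace_diagonal] at h2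
    have h3 : ∑ i, a ^ 2 * (d i * (d i - 1)) = a ^ 2 * (∑ i, d i * d i - ∑ i, d i) := by
      rw [← Finset.sum_sub_distrib, Finset.mul_sum]
      exact Finset.sum_congr rfl fun i _ => by ring
    rw [h3, h1, h2, Matrix.mul_sub, Matrix.mul_add, Matrix.mul_smul, Matrix.mul_smul,
      Matrix.trace_sub, Matrix.trace_add, Matrix.trace_smul, Matrix.trace_smul, ← hcτ]
    simp only [smul_eq_mul]
    field_simp; ring
  have hdet : Real.log (S + a ^ 2 • S - c • (S * G * S)).det =
      Real.log S.det + ∑ i, Real.log (1 - a ^ 2 * (d i - 1)) := by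
    have h1 : (S + a ^ 2 • S - c • (S * G * S)).det = S.det * ∏ i, (1 - a ^ 2 * (d i - 1)) := by
      rw [hstep, hI, Matrix.det_mul, Matrix.det_mul, det_orthogonal_conj hU2, Matrix.det_diagonal,
        ← hTT, Matrix.det_mul]
      ring
    rw [h1, Real.log_mul hSpd.det_pos.ne' (Finset.prod_pos fun i _ => (hsc i).1).ne',
      Real.log_prod fun i _ => (hsc i).1.ne']
  have hlogN : N.trace - Fintype.card ι - Real.log N.det = ∑ i, (d i - 1 - Real.log (d i)) := by
    rw [hd, trace_orthogonal_conj hU1, det_orthogonal_conj hU2, Matrix.det_diagonal,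
      Matrix.trace_diagonal, Real.log_prod fun i _ => (hb.trans_le (hNl i)).ne',
      Finset.sum_sub_distrib, Finset.sum_sub_distrib]
    simp
  rw [hlogN] at hgap
  have hsum := Finset.sum_le_sum fun i (_ : i ∈ Finset.univ) => (hsc i).2
  rw [Finset.sum_sub_distrib, Finset.sum_neg_distrib, Finset.sum_neg_distrib,
    ← Finset.mul_sum _ _ (a ^ 2 * (s / r) / 2)] at hsum
  have h1 := mul_le_mul_of_nonneg_left hsum (by positivity : 0 ≤ τ / 2)
  have h2 := mul_le_mul_of_nonneg_left hgap (by positivity : 0 ≤ a ^ 2 * (s / r) / 2)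
  have h3 : covObjective τ G (S + a ^ 2 • S - c • (S * G * S)) - covObjective τ G S =
      τ / 2 * (-∑ i, a ^ 2 * (d i * (d i - 1)) - ∑ i, Real.log (1 - a ^ 2 * (d i - 1))) := by
    rw [covObjective, covObjective, htr, hdet]; ring
  rw [h3]
  linarith

end CovarianceUpdate

end LQC

namespace LQC

/-! ### Second moments of random vectors. -/

section Moments

set_option linter.unusedSectionVars false

variable {d e : ℕ} {Ω : Type*} [MeasurableSpace Ω] {P : Measure Ω}

/-- The matrix `𝔼[Y Yᵀ]` of a random vector. -/
noncomputable def momentMatrix (P : Measure Ω) (Y : Ω → Vec d) : Matrix (Fin d) (Fin d) ℝ :=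
  Matrix.of fun i j => ∫ ω, Y ω i * Y ω j ∂P

theorem memLp_coord {Y : Ω → Vec d} (h : MemLp Y 2 P) (i : Fin d) :
    MemLp (fun ω => Y ω i) 2 P :=
  (EuclideanSpace.proj (𝕜 := ℝ) i).comp_memLp' h

theorem integrable_coord_mul {Y : Ω → Vec d} (h : MemLp Y 2 P) {Z : Ω → Vec e}
    (h' : MemLp Z 2 P) (i : Fin d) (j : Fin e) : Integrable (fun ω => Y ω i * Z ω j) P :=
  (memLp_coord h i).integrable_mul (memLp_coord h' j)

theorem quadratic_eq_sum (N : Matrix (Fin d) (Fin d) ℝ) (x : Fin d → ℝ) :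
    x ⬝ᵥ N *ᵥ x = ∑ i, ∑ j, N i j * (x i * x j) := by
  simp only [dotProduct, Matrix.mulVec, Finset.mul_sum]
  exact Finset.sum_congr rfl fun i _ => Finset.sum_congr rfl fun j _ => by ring

theorem integrable_quadratic {Y : Ω → Vec d} (h : MemLp Y 2 P) (N : Matrix (Fin d) (Fin d) ℝ) :
    Integrable (fun ω => (Y ω).ofLp ⬝ᵥ N *ᵥ (Y ω).ofLp) P := by
  simp only [quadratic_eq_sum]
  exact integrable_finsetSum _ fun i _ => integrable_finsetSum _ fun j _ =>
    (integrable_coord_mul h h i j).const_mul _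

theorem integral_quadratic {Y : Ω → Vec d} (h : MemLp Y 2 P) (N : Matrix (Fin d) (Fin d) ℝ) :
    ∫ ω, (Y ω).ofLp ⬝ᵥ N *ᵥ (Y ω).ofLp ∂P = (N * momentMatrix P Y).trace := by
  have hint : ∀ i j, Integrable (fun ω => N i j * (Y ω i * Y ω j)) P := fun i j =>
    (integrable_coord_mul h h i j).const_mul _
  simp only [quadratic_eq_sum]
  rw [integral_finsetSum _ fun i _ => integrable_finsetSum _ fun j _ => hint i j]
  simp only [Matrix.trace, Matrix.diag, Matrix.mul_apply, momentMatrix, Matrix.of_apply]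
  refine Finset.sum_congr rfl fun i _ => ?_
  rw [integral_finsetSum _ fun j _ => hint i j]
  refine Finset.sum_congr rfl fun j _ => ?_
  rw [integral_const_mul]
  simp only [mul_comm]

theorem momentMatrix_nonneg {Y : Ω → Vec d} (h : MemLp Y 2 P) : 0 ≤ momentMatrix P Y := by
  rw [nonneg_iff_quadratic]
  refine ⟨?_, fun x => ?_⟩
  · ext i j; simp [momentMatrix, mul_comm]
  -- The form at `x` is the expectation of `(x·Y)²`, the quadratic form of the rank-one matrix
  -- `xxᵀ`.
  · have h1 := integral_quadratic h (Matrix.vecMulVec x x)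
    have h2 : (Matrix.vecMulVec x x * momentMatrix P Y).trace = x ⬝ᵥ momentMatrix P Y *ᵥ x := by
      rw [Matrix.vecMulVec_mul, Matrix.trace_vecMulVec, Matrix.dotProduct_mulVec, dotProduct_comm]
    rw [← h2, ← h1]
    refine integral_nonneg fun ω => ?_
    simp only [Matrix.vecMulVec_mulVec, dotProduct_smul, Pi.zero_apply, MulOpposite.smul_eq_mul_unop,
      MulOpposite.unop_op]
    rw [dotProduct_comm x]
    exact mul_self_nonneg _

/-- The continuous linear map of a matrix. -/
noncomputable def matrixCLM (L : Matrix (Fin e) (Fin d) ℝ) : Vec d →L[ℝ] Vec e :=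
  LinearMap.toContinuousLinearMap (Matrix.toEuclideanLin L)

theorem memLp_toEuclideanLin {Y : Ω → Vec d} (h : MemLp Y 2 P) (L : Matrix (Fin e) (Fin d) ℝ) :
    MemLp (fun ω => Matrix.toEuclideanLin L (Y ω)) 2 P :=
  (matrixCLM L).comp_memLp' h

theorem toEuclideanLin_coord (L : Matrix (Fin e) (Fin d) ℝ) (x : Vec d) (i : Fin e) :
    Matrix.toEuclideanLin L x i = ∑ j, L i j * x j := rfl

theorem momentMatrix_toEuclideanLin {Y : Ω → Vec d} (h : MemLp Y 2 P)
    (L : Matrix (Fin e) (Fin d) ℝ) :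
    momentMatrix P (fun ω => Matrix.toEuclideanLin L (Y ω)) = L * momentMatrix P Y * Lᵀ := by
  ext i j
  simp only [momentMatrix, Matrix.of_apply, toEuclideanLin_coord, Finset.sum_mul_sum,
    Matrix.mul_apply, Matrix.transpose_apply]
  simp only [Finset.sum_mul]
  have hint : ∀ p q, Integrable (fun ω => L i p * Y ω p * (L j q * Y ω q)) P := fun p q => by
    have := (integrable_coord_mul h h p q).const_mul (L i p * L j q)
    refine this.congr (Filter.Eventually.of_forall fun ω => ?_)
    simp only []; ring
  rw [integral_finsetSum _ fun p _ => integrable_finsetSum _ fun q _ => hint p q, Finset.sum_comm]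
  refine Finset.sum_congr rfl fun p _ => ?_
  rw [integral_finsetSum _ fun q _ => hint p q]
  refine Finset.sum_congr rfl fun q _ => ?_
  rw [mul_right_comm, ← integral_const_mul]
  refine integral_congr_ae (Filter.Eventually.of_forall fun ω => ?_)
  simp only []; ring

variable {ν : Measure (Vec e)} [IsProbabilityMeasure P] [IsProbabilityMeasure ν]

theorem memLp_prod_fst {Y : Ω → Vec d} (h : MemLp Y 2 P) :
    MemLp (fun p : Ω × Vec e => Y p.1) 2 (P.prod ν) :=
  h.comp_measurePreserving measurePreserving_fst

theorem memLp_prod_snd (h : MemLp (fun v : Vec e => v) 2 ν) :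
    MemLp (fun p : Ω × Vec e => p.2) 2 (P.prod ν) :=
  h.comp_measurePreserving measurePreserving_snd

/-- Second moments of the sum of a random vector and an independent centered one. -/
theorem momentMatrix_add_indep {Y : Ω → Vec d} (h : MemLp Y 2 P)
    (hν : MemLp (fun v : Vec e => v) 2 ν) (hmean : ∫ v, v ∂ν = 0) (H : Matrix (Fin d) (Fin e) ℝ) :
    momentMatrix (P.prod ν) (fun p => Y p.1 + Matrix.toEuclideanLin H p.2) =
      momentMatrix P Y + H * secondMoment ν * Hᵀ := by
  have hV : secondMoment ν = momentMatrix ν fun v => v := rfl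
  have hH := memLp_toEuclideanLin hν H
  rw [hV, ← momentMatrix_toEuclideanLin hν]
  have hmean' : ∀ i, ∫ v, Matrix.toEuclideanLin H v i ∂ν = 0 := fun i => by
    have h1 := ((EuclideanSpace.proj (𝕜 := ℝ) i).comp (matrixCLM H)).integral_comp_comm
      (hν.integrable one_le_two)
    rw [hmean, map_zero] at h1
    exact h1
  have h1 := memLp_prod_fst (ν := ν) h
  have h2 := memLp_toEuclideanLin (memLp_prod_snd (P := P) hν) H
  ext i j
  simp only [momentMatrix, Matrix.of_apply, Matrix.add_apply, PiLp.add_apply, add_mul, mul_add]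
  have i1 := integrable_coord_mul h1 h1 i j
  have i2 := integrable_coord_mul h1 h2 i j
  have i3 := integrable_coord_mul h2 h1 i j
  have i4 := integrable_coord_mul h2 h2 i j
  have e1 : ∫ p : Ω × Vec e, Y p.1 i * Y p.1 j ∂(P.prod ν) = ∫ ω, Y ω i * Y ω j ∂P := by
    have := integral_prod_mul (μ := P) (ν := ν) (fun ω => Y ω i * Y ω j) (fun _ => (1 : ℝ))
    simpa using this
  have e2 : ∫ p : Ω × Vec e, Y p.1 i * Matrix.toEuclideanLin H p.2 j ∂(P.prod ν) = 0 := by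
    rw [integral_prod_mul (μ := P) (ν := ν) (fun ω => Y ω i)
      (fun v => Matrix.toEuclideanLin H v j), hmean', mul_zero]
  have e3 : ∫ p : Ω × Vec e, Matrix.toEuclideanLin H p.2 i * Y p.1 j ∂(P.prod ν) = 0 := by
    simp only [mul_comm (Matrix.toEuclideanLin H _ i)]
    rw [integral_prod_mul (μ := P) (ν := ν) (fun ω => Y ω j)
      (fun v => Matrix.toEuclideanLin H v i), hmean', mul_zero]
  have e4 : ∫ p : Ω × Vec e, Matrix.toEuclideanLin H p.2 i * Matrix.toEuclideanLin H p.2 j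
      ∂(P.prod ν) = ∫ v, Matrix.toEuclideanLin H v i * Matrix.toEuclideanLin H v j ∂ν := by
    have := integral_prod_mul (μ := P) (ν := ν) (fun _ => (1 : ℝ))
      (fun v => Matrix.toEuclideanLin H v i * Matrix.toEuclideanLin H v j)
    simpa using this
  have := integral_add (i1.add i3) (i2.add i4)
  simp only [Pi.add_apply] at this
  rw [this, integral_add i1 i3, integral_add i2 i4, e1, e2, e3, e4]
  ring

end Moments

/-! ### The Gaussian policy as a shift of state-independent noise. -/

section GaussianPolicy

variable {n k : ℕ}

theorem memLp_multivariateGaussian (S : Matrix (Fin k) (Fin k) ℝ) :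
    MemLp (fun v : Vec k => v) 2 (multivariateGaussian 0 S) :=
  IsGaussian.memLp_two_id

theorem secondMoment_multivariateGaussian {S : Matrix (Fin k) (Fin k) ℝ} (hS : S.PosSemidef) :
    secondMoment (multivariateGaussian (0 : Vec k) S) = S := by
  have hL := memLp_multivariateGaussian S
  have hmean : ∀ i, ∫ v : Vec k, v i ∂(multivariateGaussian 0 S) = 0 := fun i => by
    have h1 := (EuclideanSpace.proj (𝕜 := ℝ) i).integral_comp_comm (hL.integrable one_le_two)
    rw [integral_id_multivariateGaussian, map_zero] at h1
    exact h1
  ext i j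
  have h1 := covariance_eval_multivariateGaussian (μ := 0) hS i j
  rw [covariance_eq_sub (memLp_coord hL i) (memLp_coord hL j), hmean, hmean, mul_zero,
    sub_zero] at h1
  exact h1

theorem measurable_toEuclideanLin {d e : ℕ} (L : Matrix (Fin e) (Fin d) ℝ) :
    Measurable (Matrix.toEuclideanLin L) :=
  (matrixCLM L).continuous.measurable

theorem policy_apply_eq (K : Matrix (Fin k) (Fin n) ℝ) (S : Matrix (Fin k) (Fin k) ℝ) (x : Vec n) :
    policy K S x =
      (multivariateGaussian 0 S).map fun v => -Matrix.toEuclideanLin K x + v := by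
  change multivariateGaussian _ S = _
  rw [multivariateGaussian, multivariateGaussian, Measure.map_map (by fun_prop) (by fun_prop)]
  congr 1
  funext v
  simp

/-- Exhibits the state-action law as the image of a product measure, which makes the action noise
independent of the state. -/
theorem compProd_policy_eq (m : Measure (Vec n)) [IsProbabilityMeasure m]
    (K : Matrix (Fin k) (Fin n) ℝ) (S : Matrix (Fin k) (Fin k) ℝ) :
    m ⊗ₘ policy K S = (m.prod (multivariateGaussian 0 S)).map
      fun p => (p.1, -Matrix.toEuclideanLin K p.1 + p.2) := by
  have hK := measurable_toEuclideanLin K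
  have hm : Measurable fun p : Vec n × Vec k => (p.1, -Matrix.toEuclideanLin K p.1 + p.2) := by
    fun_prop
  ext s hs
  rw [Measure.compProd_apply hs, Measure.map_apply hm hs, Measure.prod_apply (hm hs)]
  refine lintegral_congr fun x => ?_
  rw [policy_apply_eq, Measure.map_apply (by fun_prop) (measurable_prodMk_left hs)]
  rfl

end GaussianPolicy

/-! ### Marginals of the trajectory law. -/

namespace Model

variable {n k : ℕ} (𝓜 : Model n k) (K : Matrix (Fin k) (Fin n) ℝ) (S : Matrix (Fin k) (Fin k) ℝ)

/-- The law of the state at time `t`. -/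
noncomputable def stateLaw : ℕ → Measure (Vec n)
  | 0 => 𝓜.init
  | t + 1 => (stateLaw t ⊗ₘ policy K S).bind 𝓜.transition

instance isProbabilityMeasure_stateLaw (t : ℕ) : IsProbabilityMeasure (𝓜.stateLaw K S t) := by
  induction t with
  | zero => exact 𝓜.init_prob
  | succ t ih => rw [stateLaw]; infer_instance

/-- The next action depends only on the next state, so the state-action marginals are determined by
a recursion on state laws alone. -/
theorem bind_step_eq (ν : Measure (Vec n × Vec k)) [IsProbabilityMeasure ν] :
    ν.bind (𝓜.step K S) = (ν.bind 𝓜.transition) ⊗ₘ policy K S := by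
  ext s hs
  rw [Measure.bind_apply hs (Kernel.aemeasurable _), Measure.compProd_apply hs,
    Measure.lintegral_bind (Kernel.aemeasurable _)
      (Kernel.measurable_kernel_prodMk_left hs).aemeasurable]
  refine lintegral_congr fun z => ?_
  rw [step, Kernel.compProd_apply hs]
  rfl

theorem map_eval_pathLaw_zero :
    (𝓜.pathLaw K S).map (fun ω => ω 0) = 𝓜.init ⊗ₘ policy K S := by
  have h0 : (fun ω : ℕ → Vec n × Vec k => ω 0) =
      (fun h : (i : Finset.Iic 0) → Vec n × Vec k => h ⟨0, Finset.mem_Iic.2 le_rfl⟩) ∘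
        Preorder.frestrictLe (π := fun _ => Vec n × Vec k) 0 := rfl
  rw [h0, ← Measure.map_map (by fun_prop) (by fun_prop), pathLaw, Kernel.trajMeasure,
    Measure.map_comp _ _ (by fun_prop), Kernel.traj_map_frestrictLe, Kernel.partialTraj_self,
    Measure.id_comp, Measure.map_map (by fun_prop) (by fun_prop)]
  exact Measure.map_id

theorem map_eval_pathLaw_succ (t : ℕ) :
    (𝓜.pathLaw K S).map (fun ω => ω (t + 1)) =
      ((𝓜.pathLaw K S).map fun ω => ω t).bind (𝓜.step K S) := by
  have h0 : (fun ω : ℕ → Vec n × Vec k => ω (t + 1)) =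
      Prod.snd ∘ fun ω => (Preorder.frestrictLe (π := fun _ => Vec n × Vec k) t ω, ω (t + 1)) := rfl
  have h1 : (fun ω : ℕ → Vec n × Vec k => ω t) =
      (fun h : (i : Finset.Iic t) → Vec n × Vec k => h ⟨t, Finset.mem_Iic.2 le_rfl⟩) ∘
        Preorder.frestrictLe (π := fun _ => Vec n × Vec k) t := rfl
  rw [h0, ← Measure.map_map (by fun_prop) (by fun_prop), pathLaw,
    ← Kernel.map_frestrictLe_trajMeasure_compProd_eq_map_trajMeasure, h1,
    ← Measure.map_map (by fun_prop) (by fun_prop)]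
  change Measure.snd _ = _
  rw [Measure.snd_compProd]
  ext s hs
  rw [Measure.bind_apply hs (Kernel.aemeasurable _), Measure.bind_apply hs (Kernel.aemeasurable _),
    lintegral_map (Kernel.measurable_coe _ hs) (by fun_prop),
    lintegral_map (Kernel.measurable_coe _ hs) (by fun_prop)]
  have hm : Measurable fun h : (i : Finset.Iic t) → Vec n × Vec k =>
      𝓜.step K S (h ⟨t, Finset.mem_Iic.2 le_rfl⟩) s :=
    (Kernel.measurable_coe (𝓜.step K S) hs).comp
      (measurable_pi_apply (⟨t, Finset.mem_Iic.2 le_rfl⟩ : Finset.Iic t))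
  rw [lintegral_map hm (by fun_prop)]
  rfl

theorem map_eval_pathLaw (t : ℕ) :
    (𝓜.pathLaw K S).map (fun ω => ω t) = 𝓜.stateLaw K S t ⊗ₘ policy K S := by
  induction t with
  | zero => exact 𝓜.map_eval_pathLaw_zero K S
  | succ t ih => rw [map_eval_pathLaw_succ, ih, bind_step_eq, stateLaw]

end Model

end LQC

/-! ### Moment recursion and expected stage costs. -/

namespace LQC
namespace Model

variable {n k : ℕ} (𝓜 : Model n k) (K : Matrix (Fin k) (Fin n) ℝ) (S : Matrix (Fin k) (Fin k) ℝ)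

/-- Closed-loop form `x' = (A-BK)x + Bv + w` with independent `x`, `v`, `w`. The identity matrix on
`w` puts the sum in the shape required by `momentMatrix_add_indep`. -/
theorem stateLaw_succ_eq (t : ℕ) :
    𝓜.stateLaw K S (t + 1) =
      (((𝓜.stateLaw K S t).prod (multivariateGaussian 0 S)).prod 𝓜.noise).map fun p =>
        (Matrix.toEuclideanLin (𝓜.A - 𝓜.B * K) p.1.1 + Matrix.toEuclideanLin 𝓜.B p.1.2) +
          Matrix.toEuclideanLin 1 p.2 := by
  have hA := measurable_toEuclideanLin 𝓜.A
  have hB := measurable_toEuclideanLin 𝓜.B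
  have hK := measurable_toEuclideanLin K
  have hF := measurable_toEuclideanLin (𝓜.A - 𝓜.B * K)
  have h1 := measurable_toEuclideanLin (1 : Matrix (Fin n) (Fin n) ℝ)
  have hm : Measurable fun p : (Vec n × Vec k) × Vec n =>
      (Matrix.toEuclideanLin (𝓜.A - 𝓜.B * K) p.1.1 + Matrix.toEuclideanLin 𝓜.B p.1.2) +
          Matrix.toEuclideanLin 1 p.2 := by fun_prop
  ext s hs
  rw [stateLaw, Measure.bind_apply hs (Kernel.aemeasurable _), compProd_policy_eq,
    lintegral_map (Kernel.measurable_coe _ hs) (by fun_prop), Measure.map_apply hm hs,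
    Measure.prod_apply (hm hs)]
  refine lintegral_congr fun x => ?_
  change (𝓜.noise.map _) s = _
  rw [Measure.map_apply (by fun_prop) hs]
  congr 1
  ext w
  have : Matrix.toEuclideanLin 𝓜.A x.1 +
      Matrix.toEuclideanLin 𝓜.B (-Matrix.toEuclideanLin K x.1 + x.2) + w =
      (Matrix.toEuclideanLin (𝓜.A - 𝓜.B * K) x.1 + Matrix.toEuclideanLin 𝓜.B x.2) +
          Matrix.toEuclideanLin 1 w := by
    have e1 : Matrix.toEuclideanLin (𝓜.A - 𝓜.B * K) x.1 =
        Matrix.toEuclideanLin 𝓜.A x.1 - Matrix.toEuclideanLin 𝓜.B (Matrix.toEuclideanLin K x.1) := by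
      apply WithLp.ofLp_injective
      change (𝓜.A - 𝓜.B * K) *ᵥ x.1.ofLp = 𝓜.A *ᵥ x.1.ofLp - 𝓜.B *ᵥ (K *ᵥ x.1.ofLp)
      rw [Matrix.sub_mulVec, Matrix.mulVec_mulVec]
    have e2 : Matrix.toEuclideanLin (1 : Matrix (Fin n) (Fin n) ℝ) w = w := by
      apply WithLp.ofLp_injective
      exact Matrix.one_mulVec _
    rw [e1, e2, map_add, map_neg]
    abel
  simp only [Set.mem_preimage, this]

/-- The second moment matrix of the state at time `t`. -/
noncomputable def stateMoment (t : ℕ) : Matrix (Fin n) (Fin n) ℝ :=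
  secondMoment (𝓜.stateLaw K S t)

theorem stateLaw_succ_moment {t : ℕ} (h : MemLp (fun x : Vec n => x) 2 (𝓜.stateLaw K S t))
    (hS : S.PosSemidef) :
    MemLp (fun x : Vec n => x) 2 (𝓜.stateLaw K S (t + 1)) ∧
      𝓜.stateMoment K S (t + 1) = (𝓜.A - 𝓜.B * K) * 𝓜.stateMoment K S t * (𝓜.A - 𝓜.B * K)ᵀ +
        (𝓜.B * S * 𝓜.Bᵀ + 𝓜.W) := by
  have hB := measurable_toEuclideanLin 𝓜.B
  have hF := measurable_toEuclideanLin (𝓜.A - 𝓜.B * K)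
  have hI := measurable_toEuclideanLin (1 : Matrix (Fin n) (Fin n) ℝ)
  have hg := memLp_multivariateGaussian S
  have h1 := memLp_toEuclideanLin h (𝓜.A - 𝓜.B * K)
  have h2 : MemLp (fun p : Vec n × Vec k => Matrix.toEuclideanLin (𝓜.A - 𝓜.B * K) p.1 +
      Matrix.toEuclideanLin 𝓜.B p.2) 2 ((𝓜.stateLaw K S t).prod (multivariateGaussian 0 S)) :=
    (memLp_prod_fst h1).add (memLp_toEuclideanLin (memLp_prod_snd hg) 𝓜.B)
  have h3 := (memLp_prod_fst (ν := 𝓜.noise) h2).add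
    (memLp_toEuclideanLin (memLp_prod_snd
      (P := (𝓜.stateLaw K S t).prod (multivariateGaussian 0 S)) 𝓜.noise_memLp) 1)
  have hm : Measurable fun p : (Vec n × Vec k) × Vec n =>
      (Matrix.toEuclideanLin (𝓜.A - 𝓜.B * K) p.1.1 + Matrix.toEuclideanLin 𝓜.B p.1.2) +
          Matrix.toEuclideanLin 1 p.2 := by fun_prop
  constructor
  · rw [stateLaw_succ_eq]
    exact (memLp_map_measure_iff (by fun_prop) hm.aemeasurable).2 h3
  · have e1 := momentMatrix_add_indep h2 𝓜.noise_memLp 𝓜.noise_mean 1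
    have e2 := momentMatrix_add_indep h1 hg integral_id_multivariateGaussian 𝓜.B
    rw [secondMoment_multivariateGaussian hS, momentMatrix_toEuclideanLin h] at e2
    rw [e2, Matrix.one_mul, Matrix.transpose_one, Matrix.mul_one] at e1
    rw [← add_assoc]
    refine Eq.trans ?_ e1
    ext i j
    simp only [stateMoment, secondMoment, momentMatrix, Matrix.of_apply]
    rw [stateLaw_succ_eq, integral_map hm.aemeasurable
      (by fun_prop : Measurable fun x : Vec n => x i * x j).aestronglyMeasurable]

theorem memLp_stateLaw (hS : S.PosSemidef) (t : ℕ) :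
    MemLp (fun x : Vec n => x) 2 (𝓜.stateLaw K S t) := by
  induction t with
  | zero => exact 𝓜.init_memLp
  | succ t ih => exact (𝓜.stateLaw_succ_moment K S ih hS).1

theorem W_nonneg : 0 ≤ 𝓜.W := momentMatrix_nonneg 𝓜.noise_memLp

theorem initMoment_nonneg : 0 ≤ secondMoment 𝓜.init := momentMatrix_nonneg 𝓜.init_memLp

theorem isMomentSeq_stateMoment (hS : S.PosSemidef) :
    IsMomentSeq (𝓜.A - 𝓜.B * K) (𝓜.B * S * 𝓜.Bᵀ + 𝓜.W) (𝓜.stateMoment K S) where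
  zero_nonneg := 𝓜.initMoment_nonneg
  noise_nonneg := add_nonneg (conj_nonneg' hS.nonneg _) 𝓜.W_nonneg
  succ t := (𝓜.stateLaw_succ_moment K S (𝓜.memLp_stateLaw K S hS t) hS).2

/-- The normalization constant `log ((2π)ᵏ det S)`. -/
noncomputable def logNorm (S : Matrix (Fin k) (Fin k) ℝ) : ℝ :=
  Real.log ((2 * Real.pi) ^ k * S.det)

theorem log_gaussianDensity (hS : S.PosDef) (m v : Vec k) :
    Real.log (gaussianDensity m S (m + v)) =
      -(1 / 2) * logNorm S - 1 / 2 * (v.ofLp ⬝ᵥ S⁻¹ *ᵥ v.ofLp) := by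
  have h1 : 0 < (2 * Real.pi) ^ k * S.det := mul_pos (by positivity) hS.det_pos
  rw [gaussianDensity, Real.log_mul (by positivity) (Real.exp_pos _).ne', Real.log_inv,
    Real.log_sqrt h1.le, Real.log_exp, add_sub_cancel_left, logNorm]
  ring

/-- The expected stage cost at time `t`. -/
noncomputable def meanStageCost (t : ℕ) : ℝ :=
  ((𝓜.Q + Kᵀ * 𝓜.R * K) * 𝓜.stateMoment K S t).trace +
    ((𝓜.R * S).trace - 𝓜.τ / 2 * (k + logNorm S))

theorem stageCost_eq (hS : S.PosDef) (p : Vec n × Vec k) :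
    𝓜.stageCost K S (p.1, -Matrix.toEuclideanLin K p.1 + p.2) =
      p.1.ofLp ⬝ᵥ 𝓜.Q *ᵥ p.1.ofLp +
        (Matrix.toEuclideanLin (-K) p.1 + Matrix.toEuclideanLin 1 p.2).ofLp ⬝ᵥ
          𝓜.R *ᵥ (Matrix.toEuclideanLin (-K) p.1 + Matrix.toEuclideanLin 1 p.2).ofLp +
        𝓜.τ * (-(1 / 2) * logNorm S - 1 / 2 * (p.2.ofLp ⬝ᵥ S⁻¹ *ᵥ p.2.ofLp)) := by
  have e1 : Matrix.toEuclideanLin (-K) p.1 = -Matrix.toEuclideanLin K p.1 := by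
    rw [map_neg]; rfl
  have e2 : Matrix.toEuclideanLin (1 : Matrix (Fin k) (Fin k) ℝ) p.2 = p.2 := by
    apply WithLp.ofLp_injective
    exact Matrix.one_mulVec _
  rw [e1, e2, stageCost, log_gaussianDensity S hS]

theorem measurable_stageCost : Measurable (𝓜.stageCost K S) := by
  have hK := (matrixCLM K).continuous
  have h0 : Continuous fun z : Vec n × Vec k => Matrix.toEuclideanLin K z.1 :=
    hK.comp continuous_fst
  have h1 : Continuous fun z : Vec n × Vec k =>
      gaussianDensity (-Matrix.toEuclideanLin K z.1) S z.2 := by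
    unfold gaussianDensity
    fun_prop
  have h2 : Continuous fun z : Vec n × Vec k =>
      z.1.ofLp ⬝ᵥ 𝓜.Q *ᵥ z.1.ofLp + z.2.ofLp ⬝ᵥ 𝓜.R *ᵥ z.2.ofLp := by fun_prop
  unfold stageCost
  exact h2.measurable.add ((Real.measurable_log.comp h1.measurable).const_mul _)

theorem integral_stageCost (hS : S.PosDef) (t : ℕ) :
    Integrable (𝓜.stageCost K S) (𝓜.stateLaw K S t ⊗ₘ policy K S) ∧
      ∫ z, 𝓜.stageCost K S z ∂(𝓜.stateLaw K S t ⊗ₘ policy K S) = 𝓜.meanStageCost K S t := by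
  have hK := measurable_toEuclideanLin K
  have hm : Measurable fun p : Vec n × Vec k => (p.1, -Matrix.toEuclideanLin K p.1 + p.2) := by
    fun_prop
  have hg := memLp_multivariateGaussian S
  have hx := 𝓜.memLp_stateLaw K S hS.posSemidef t
  have hx' := memLp_prod_fst (ν := multivariateGaussian (0 : Vec k) S) hx
  have hg' := memLp_prod_snd (P := 𝓜.stateLaw K S t) hg
  have h1 := memLp_toEuclideanLin hx (-K)
  have hu : MemLp (fun p : Vec n × Vec k => Matrix.toEuclideanLin (-K) p.1 +
      Matrix.toEuclideanLin 1 p.2) 2 ((𝓜.stateLaw K S t).prod (multivariateGaussian 0 S)) :=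
    (memLp_prod_fst h1).add (memLp_toEuclideanLin hg' 1)
  have i1 := integrable_quadratic hx' 𝓜.Q
  have i2 := integrable_quadratic hu 𝓜.R
  have i3 := integrable_quadratic hg' S⁻¹
  have i4 := ((integrable_const (μ := (𝓜.stateLaw K S t).prod (multivariateGaussian (0 : Vec k) S))
    (-(1 / 2) * logNorm S)).sub (i3.const_mul (1 / 2))).const_mul 𝓜.τ
  have hms := (𝓜.measurable_stageCost K S)
  rw [compProd_policy_eq]
  constructor
  · rw [integrable_map_measure hms.aestronglyMeasurable hm.aemeasurable]
    refine ((i1.add i2).add i4).congr (Filter.Eventually.of_forall fun p => ?_)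
    exact (𝓜.stageCost_eq K S hS p).symm
  · rw [integral_map hm.aemeasurable hms.aestronglyMeasurable]
    simp only [stageCost_eq _ _ _ hS]
    have e0 := integral_add (i1.add i2) i4
    simp only [Pi.add_apply, Pi.sub_apply] at e0
    rw [e0, integral_add i1 i2, integral_const_mul 𝓜.τ,
      integral_sub (integrable_const _) (i3.const_mul _), integral_const_mul (1 / 2),
      integral_quadratic hx', integral_quadratic hu, integral_quadratic hg']
    -- Taking `H = 0` removes the action noise, leaving the moment of the first marginal.
    have f1 : momentMatrix ((𝓜.stateLaw K S t).prod (multivariateGaussian (0 : Vec k) S))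
        (fun p => p.1) = 𝓜.stateMoment K S t := by
      have := momentMatrix_add_indep hx hg integral_id_multivariateGaussian
        (0 : Matrix (Fin n) (Fin k) ℝ)
      simp only [map_zero, LinearMap.zero_apply, add_zero, Matrix.zero_mul] at this
      exact this
    have f2 : momentMatrix ((𝓜.stateLaw K S t).prod (multivariateGaussian (0 : Vec k) S))
        (fun p => p.2) = S := by
      have := momentMatrix_add_indep (P := 𝓜.stateLaw K S t) (Y := fun _ => (0 : Vec k))
        (memLp_const 0) hg integral_id_multivariateGaussian 1
      rw [secondMoment_multivariateGaussian hS.posSemidef] at this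
      simp only [zero_add, Matrix.one_mul, Matrix.transpose_one, Matrix.mul_one] at this
      convert this using 1
      · congr 1
        funext p
        apply WithLp.ofLp_injective
        exact (Matrix.one_mulVec _).symm
      · ext i j; simp [momentMatrix]
    have f3 := momentMatrix_add_indep h1 hg integral_id_multivariateGaussian 1
    rw [secondMoment_multivariateGaussian hS.posSemidef, momentMatrix_toEuclideanLin hx] at f3
    rw [f1, f2, f3]
    have f4 : momentMatrix (𝓜.stateLaw K S t) (fun x => x) = 𝓜.stateMoment K S t := rfl
    -- Its trace is the `k` of the Gaussian entropy.
    have f5 : S⁻¹ * S = 1 := Matrix.nonsing_inv_mul _ hS.det_pos.ne'.isUnit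
    have f6 : (𝓜.R * (-K * 𝓜.stateMoment K S t * (-K)ᵀ)).trace =
        (Kᵀ * 𝓜.R * K * 𝓜.stateMoment K S t).trace := by
      rw [Matrix.transpose_neg, Matrix.mul_neg, Matrix.neg_mul, Matrix.neg_mul, neg_neg,
        ← Matrix.mul_assoc, Matrix.trace_mul_comm _ Kᵀ]
      simp only [Matrix.mul_assoc]
    rw [f4, f5, Matrix.mul_add, Matrix.trace_add, f6, Matrix.trace_one, meanStageCost,
      Matrix.add_mul, Matrix.trace_add]
    simp
    ring

/-- The negative parts of the stage costs have uniformly bounded expectations. -/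
theorem exists_lintegral_neg_stageCost_le (hS : S.PosDef) :
    ∃ D : ℝ, 0 ≤ D ∧ ∀ t, ∫⁻ z, ENNReal.ofReal (-𝓜.stageCost K S z)
      ∂(𝓜.stateLaw K S t ⊗ₘ policy K S) ≤ ENNReal.ofReal D := by
  have hK := measurable_toEuclideanLin K
  have hm : Measurable fun p : Vec n × Vec k => (p.1, -Matrix.toEuclideanLin K p.1 + p.2) := by
    fun_prop
  have hg := memLp_multivariateGaussian S
  -- Only the log-density can be negative, and `f` bounds its negative part. It depends on the
  -- action noise alone, whose law is the same at every time.
  set f : Vec k → ℝ := fun v => 𝓜.τ / 2 * (|logNorm S| + v.ofLp ⬝ᵥ S⁻¹ *ᵥ v.ofLp) with hf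
  have hSi : ∀ v : Fin k → ℝ, 0 ≤ v ⬝ᵥ S⁻¹ *ᵥ v := fun v =>
    (nonneg_iff_quadratic.1 hS.inv.posSemidef.nonneg).2 v
  have hf0 : ∀ v, 0 ≤ f v := fun v =>
    mul_nonneg (by have := 𝓜.τ_pos; positivity) (add_nonneg (abs_nonneg _) (hSi _))
  have hfi : Integrable f (multivariateGaussian 0 S) :=
    ((integrable_const _).add (integrable_quadratic hg S⁻¹)).const_mul _
  have hneg : Measurable fun z => ENNReal.ofReal (-𝓜.stageCost K S z) :=
    (𝓜.measurable_stageCost K S).neg.ennreal_ofReal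
  refine ⟨∫ v, f v ∂(multivariateGaussian 0 S), integral_nonneg hf0, fun t => ?_⟩
  rw [ofReal_integral_eq_lintegral_ofReal hfi (Filter.Eventually.of_forall hf0),
    compProd_policy_eq, lintegral_map hneg hm]
  have h1 : ∫⁻ v, ENNReal.ofReal (f v) ∂(multivariateGaussian 0 S) =
      ∫⁻ p : Vec n × Vec k, ENNReal.ofReal (f p.2)
        ∂((𝓜.stateLaw K S t).prod (multivariateGaussian 0 S)) := by
    have hfm : Measurable f := by
      have : Continuous f := by rw [hf]; fun_prop
      exact this.measurable
    rw [lintegral_prod _ (by fun_prop)]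
    simp
  rw [h1]
  refine lintegral_mono fun p => ENNReal.ofReal_le_ofReal ?_
  rw [stageCost_eq _ _ _ hS]
  have hQ := (nonneg_iff_quadratic.1 𝓜.Q_posSemidef.nonneg).2 p.1.ofLp
  have hR := (nonneg_iff_quadratic.1 𝓜.R_posDef.posSemidef.nonneg).2
    (Matrix.toEuclideanLin (-K) p.1 + Matrix.toEuclideanLin 1 p.2).ofLp
  have hτ := mul_le_mul_of_nonneg_left (le_abs_self (logNorm S)) 𝓜.τ_pos.le
  simp only [hf]
  linarith

end Model
end LQC

/-! ### From the extended-real objective to convergent series. -/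

namespace LQC

theorem ereal_tsum_sub_eq {p q : ℕ → ℝ≥0∞} (hp : ∀ t, p t ≠ ⊤) (hq : ∀ t, q t ≠ ⊤)
    (hqs : ∑' t, q t ≠ ⊤) {C : ℝ} (h : HasSum (fun t => (p t).toReal - (q t).toReal) C) :
    ((∑' t, p t : ℝ≥0∞) : EReal) - ((∑' t, q t : ℝ≥0∞) : EReal) = (C : EReal) := by
  have hqr : Summable fun t => (q t).toReal := ENNReal.summable_toReal hqs
  have hpr : Summable fun t => (p t).toReal := by
    simpa using h.summable.add hqr
  have hps : ∑' t, p t ≠ ⊤ := by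
    have h1 := ENNReal.ofReal_tsum_of_nonneg (fun t => ENNReal.toReal_nonneg (a := p t)) hpr
    simp only [ENNReal.ofReal_toReal (hp _)] at h1
    rw [← h1]
    exact ENNReal.ofReal_ne_top
  rw [← EReal.coe_ennreal_toReal hps, ← EReal.coe_ennreal_toReal hqs, ENNReal.tsum_toReal_eq hp,
    ENNReal.tsum_toReal_eq hq, ← EReal.coe_sub, ← hpr.tsum_sub hqr, h.tsum_eq]

theorem summable_of_ereal_tsum_sub_lt_top {p q : ℕ → ℝ≥0∞} (hqs : ∑' t, q t ≠ ⊤)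
    (h : ((∑' t, p t : ℝ≥0∞) : EReal) - ((∑' t, q t : ℝ≥0∞) : EReal) < ⊤) :
    Summable fun t => (p t).toReal - (q t).toReal := by
  have hps : ∑' t, p t ≠ ⊤ := by
    intro htop
    rw [htop, ← EReal.coe_ennreal_toReal hqs] at h
    simp at h
  exact (ENNReal.summable_toReal hps).sub (ENNReal.summable_toReal hqs)

namespace Model

variable {n k : ℕ} (𝓜 : Model n k) (K : Matrix (Fin k) (Fin n) ℝ) (S : Matrix (Fin k) (Fin k) ℝ)

theorem lintegral_tsum_pathLaw {F : ℕ → Vec n × Vec k → ℝ≥0∞} (hF : ∀ t, Measurable (F t)) :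
    ∫⁻ ω, ∑' t, F t (ω t) ∂𝓜.pathLaw K S =
      ∑' t, ∫⁻ z, F t z ∂(𝓜.stateLaw K S t ⊗ₘ policy K S) := by
  have hm : ∀ t, AEMeasurable (fun ω : ℕ → Vec n × Vec k => F t (ω t)) (𝓜.pathLaw K S) := fun t =>
    ((hF t).comp (measurable_pi_apply t)).aemeasurable
  rw [lintegral_tsum hm]
  refine tsum_congr fun t => ?_
  rw [← map_eval_pathLaw, lintegral_map (hF t) (measurable_pi_apply t)]

/-- Tonelli exchanges expectation and sum in each part. The total negative part is finite
unconditionally, by comparison with a geometric series, so the difference is never `⊤ - ⊤` and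
finiteness of the cost is decided by the positive part. -/
theorem costE_eq_and_summable (hS : S.PosDef) :
    (𝓜.costE K S < ⊤ → Summable fun t => 𝓜.γ ^ t * 𝓜.meanStageCost K S t) ∧
      ∀ C : ℝ, HasSum (fun t => 𝓜.γ ^ t * 𝓜.meanStageCost K S t) C → 𝓜.costE K S = C := by
  have hms := 𝓜.measurable_stageCost K S
  set ν := fun t => 𝓜.stateLaw K S t ⊗ₘ policy K S with hν
  set p : ℕ → ℝ≥0∞ := fun t => ∫⁻ z, ENNReal.ofReal (𝓜.γ ^ t * 𝓜.stageCost K S z) ∂ν t with hp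
  set q : ℕ → ℝ≥0∞ := fun t => ∫⁻ z, ENNReal.ofReal (-(𝓜.γ ^ t * 𝓜.stageCost K S z)) ∂ν t with hq
  have hE : 𝓜.costE K S = ((∑' t, p t : ℝ≥0∞) : EReal) - ((∑' t, q t : ℝ≥0∞) : EReal) := by
    rw [costE, 𝓜.lintegral_tsum_pathLaw K S
        (F := fun t z => ENNReal.ofReal (𝓜.γ ^ t * 𝓜.stageCost K S z)) fun t => by fun_prop,
      𝓜.lintegral_tsum_pathLaw K S
        (F := fun t z => ENNReal.ofReal (-(𝓜.γ ^ t * 𝓜.stageCost K S z))) fun t => by fun_prop]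
  have hint : ∀ t, Integrable (fun z => 𝓜.γ ^ t * 𝓜.stageCost K S z) (ν t) := fun t =>
    (𝓜.integral_stageCost K S hS t).1.const_mul _
  have hdiff : ∀ t, (p t).toReal - (q t).toReal = 𝓜.γ ^ t * 𝓜.meanStageCost K S t := fun t => by
    rw [← (𝓜.integral_stageCost K S hS t).2, ← integral_const_mul,
      integral_eq_lintegral_pos_part_sub_lintegral_neg_part (hint t)]
  have hpt : ∀ t, p t ≠ ⊤ := fun t => (hint t).lintegral_lt_top.ne
  have hqt : ∀ t, q t ≠ ⊤ := fun t => (hint t).neg.lintegral_lt_top.ne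
  have hγ := 𝓜.γ_pos.le
  have hqs : ∑' t, q t ≠ ⊤ := by
    obtain ⟨D, hD0, hD⟩ := 𝓜.exists_lintegral_neg_stageCost_le K S hS
    have h1 : ∀ t, q t ≤ ENNReal.ofReal (𝓜.γ ^ t * D) := fun t => by
      rw [ENNReal.ofReal_mul (pow_nonneg hγ t)]
      simp only [hq]
      simp only [← mul_neg, ENNReal.ofReal_mul (pow_nonneg hγ t)]
      rw [lintegral_const_mul _ (by fun_prop)]
      gcongr
      exact hD t
    refine ne_top_of_le_ne_top ?_ (ENNReal.tsum_le_tsum h1)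
    rw [← ENNReal.ofReal_tsum_of_nonneg (fun t => mul_nonneg (pow_nonneg hγ t) hD0)
      ((summable_geometric_of_lt_one hγ 𝓜.γ_lt_one).mul_right D)]
    exact ENNReal.ofReal_ne_top
  constructor
  · intro h
    rw [hE] at h
    simpa only [hdiff] using summable_of_ereal_tsum_sub_lt_top hqs h
  · intro C hC
    rw [hE]
    refine ereal_tsum_sub_eq hpt hqt hqs ?_
    simpa only [hdiff] using hC

/-- The policy-independent noise and entropy contribution of one stage. -/
noncomputable def stageConst (S : Matrix (Fin k) (Fin k) ℝ) : ℝ :=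
  (𝓜.R * S).trace - 𝓜.τ / 2 * (k + logNorm S)

theorem hasSum_meanStageCost_iff {C : ℝ} :
    HasSum (fun t => 𝓜.γ ^ t * 𝓜.meanStageCost K S t) (C + (1 - 𝓜.γ)⁻¹ * 𝓜.stageConst S) ↔
      HasSum (fun t => 𝓜.γ ^ t * ((𝓜.Q + Kᵀ * 𝓜.R * K) * 𝓜.stateMoment K S t).trace) C := by
  have hgeo := (hasSum_geometric_of_lt_one 𝓜.γ_pos.le 𝓜.γ_lt_one).mul_right (𝓜.stageConst S)
  have e : ∀ t, 𝓜.γ ^ t * 𝓜.meanStageCost K S t =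
      𝓜.γ ^ t * ((𝓜.Q + Kᵀ * 𝓜.R * K) * 𝓜.stateMoment K S t).trace + 𝓜.γ ^ t * 𝓜.stageConst S :=
    fun t => mul_add _ _ _
  simp only [e]
  refine ⟨fun h => ?_, fun h => h.add hgeo⟩
  simpa only [add_sub_cancel_right] using h.sub hgeo

theorem stageMatrix_nonneg : 0 ≤ 𝓜.Q + Kᵀ * 𝓜.R * K :=
  add_nonneg 𝓜.Q_posSemidef.nonneg (conj_nonneg 𝓜.R_posDef.posSemidef.nonneg K)

/-- The gain `K` has a finite value matrix. -/
def FiniteValue : Prop :=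
  Summable (lyapTerm 𝓜.γ (𝓜.A - 𝓜.B * K) (𝓜.Q + Kᵀ * 𝓜.R * K))

theorem μ_smul_one_le : 𝓜.μ • (1 : Matrix (Fin n) (Fin n) ℝ) ≤ secondMoment 𝓜.init :=
  sigmaMin_smul_one_le 𝓜.initMoment_nonneg

theorem finiteValue_of_summable (hS : S.PosSemidef) (hμ : 0 < 𝓜.μ)
    (h : Summable fun t => 𝓜.γ ^ t *
      ((𝓜.Q + Kᵀ * 𝓜.R * K) * 𝓜.stateMoment K S t).trace) : 𝓜.FiniteValue K :=
  (𝓜.isMomentSeq_stateMoment K S hS).summable_lyapTerm 𝓜.γ_pos.le (𝓜.stageMatrix_nonneg K) hμ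
    𝓜.μ_smul_one_le h

theorem finiteValue_of_costE_lt_top (hS : S.PosDef) (hμ : 0 < 𝓜.μ) (h : 𝓜.costE K S < ⊤) :
    𝓜.FiniteValue K := by
  have h1 := (𝓜.costE_eq_and_summable K S hS).1 h
  have h2 : HasSum (fun t => 𝓜.γ ^ t * 𝓜.meanStageCost K S t)
    ((∑' t, 𝓜.γ ^ t * 𝓜.meanStageCost K S t - (1 - 𝓜.γ)⁻¹ * 𝓜.stageConst S) +
      (1 - 𝓜.γ)⁻¹ * 𝓜.stageConst S) := by rw [sub_add_cancel]; exact h1.hasSum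
  rw [hasSum_meanStageCost_iff] at h2
  exact 𝓜.finiteValue_of_summable K S hS.posSemidef hμ h2.summable

/-- The closed form of the cost. -/
theorem costE_eq_of_finiteValue (hS : S.PosDef) (h : 𝓜.FiniteValue K) :
    𝓜.costE K S = (((𝓜.valueMatrix K * secondMoment 𝓜.init).trace +
      𝓜.γ / (1 - 𝓜.γ) * (𝓜.valueMatrix K * (𝓜.B * S * 𝓜.Bᵀ + 𝓜.W)).trace +
        (1 - 𝓜.γ)⁻¹ * 𝓜.stageConst S : ℝ) : EReal) := by
  have h1 := (𝓜.isMomentSeq_stateMoment K S hS.posSemidef).hasSum_trace 𝓜.γ_pos.le 𝓜.γ_lt_one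
    (𝓜.stageMatrix_nonneg K) h
  exact (𝓜.costE_eq_and_summable K S hS).2 _ ((𝓜.hasSum_meanStageCost_iff K S).2 h1)

theorem costE_eq_of_hasSum (hS : S.PosDef) {C : ℝ}
    (h : HasSum (fun t => 𝓜.γ ^ t * ((𝓜.Q + Kᵀ * 𝓜.R * K) * 𝓜.stateMoment K S t).trace) C) :
    𝓜.costE K S = ((C + (1 - 𝓜.γ)⁻¹ * 𝓜.stageConst S : ℝ) : EReal) :=
  (𝓜.costE_eq_and_summable K S hS).2 _ ((𝓜.hasSum_meanStageCost_iff K S).2 h)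

/-- The discounted state correlation matrix as a series of second moments. -/
theorem stateCorr_eq_tsum (hS : S.PosSemidef)
    (h : Summable fun t => 𝓜.γ ^ t • 𝓜.stateMoment K S t) :
    𝓜.stateCorr K S = ∑' t, 𝓜.γ ^ t • 𝓜.stateMoment K S t := by
  have hmem := 𝓜.memLp_stateLaw K S hS
  have hγ := 𝓜.γ_pos.le
  have hm : ∀ i j, Measurable fun z : Vec n × Vec k => z.1 i * z.1 j := fun i j => by fun_prop
  have hL : ∀ t, (𝓜.pathLaw K S).map (fun ω => (ω t).1) = 𝓜.stateLaw K S t := fun t => by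
    have h0 : (fun ω : ℕ → Vec n × Vec k => (ω t).1) = Prod.fst ∘ fun ω => ω t := rfl
    rw [h0, ← Measure.map_map (by fun_prop) (by fun_prop), map_eval_pathLaw]
    exact Measure.fst_compProd _ _
  have hfst : ∀ t, Measurable fun ω : ℕ → Vec n × Vec k => (ω t).1 := fun t => by fun_prop
  have hmemω : ∀ t, MemLp (fun ω : ℕ → Vec n × Vec k => (ω t).1) 2 (𝓜.pathLaw K S) := fun t => by
    have h1 := hmem t
    rw [← hL t, memLp_map_measure_iff (by fun_prop) (hfst t).aemeasurable] at h1
    exact h1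
  have hmom : ∀ t i j, ∫ ω, (ω t).1 i * (ω t).1 j ∂𝓜.pathLaw K S = 𝓜.stateMoment K S t i j :=
    fun t i j => by
      rw [stateMoment, secondMoment, Matrix.of_apply, ← hL t, integral_map (hfst t).aemeasurable
        (by fun_prop : Measurable fun x : Vec n => x i * x j).aestronglyMeasurable]
  ext i j
  rw [stateCorr, Matrix.of_apply]
  have hint : ∀ t, Integrable (fun ω : ℕ → Vec n × Vec k => 𝓜.γ ^ t * ((ω t).1 i * (ω t).1 j))
      (𝓜.pathLaw K S) := fun t => (integrable_coord_mul (hmemω t) (hmemω t) i j).const_mul _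
  have hent := summable_matrix_iff.1 h
  -- Off-diagonal products are dominated by `xᵢ² + xⱼ²`, hence by summable diagonal moments; this
  -- justifies exchanging integral and series.
  have hsum : Summable fun t => ∫ ω, ‖𝓜.γ ^ t * ((ω t).1 i * (ω t).1 j)‖ ∂𝓜.pathLaw K S := by
    refine Summable.of_nonneg_of_le (fun t => integral_nonneg fun _ => norm_nonneg _)
      (fun t => ?_) ((hent i i).add (hent j j))
    simp only [Matrix.smul_apply, smul_eq_mul, ← hmom, ← integral_const_mul]
    have i1 := (integrable_coord_mul (hmemω t) (hmemω t) i i).const_mul (𝓜.γ ^ t)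
    have i2 := (integrable_coord_mul (hmemω t) (hmemω t) j j).const_mul (𝓜.γ ^ t)
    rw [← integral_add i1 i2]
    refine integral_mono (hint t).norm (i1.add i2) fun ω => ?_
    simp only []
    rw [Real.norm_eq_abs, abs_mul, abs_of_nonneg (pow_nonneg hγ t), ← mul_add]
    refine mul_le_mul_of_nonneg_left ?_ (pow_nonneg hγ t)
    rw [abs_le]
    constructor <;> nlinarith [sq_nonneg ((ω t).1 i + (ω t).1 j), sq_nonneg ((ω t).1 i - (ω t).1 j),
      mul_self_nonneg ((ω t).1 i), mul_self_nonneg ((ω t).1 j)]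
  rw [← integral_tsum_of_summable_integral_norm hint hsum]
  simp only [integral_const_mul, hmom]
  have h1 : HasSum (fun t => (𝓜.γ ^ t • 𝓜.stateMoment K S t) i j)
      ((∑' t, 𝓜.γ ^ t • 𝓜.stateMoment K S t) i j) :=
    Pi.hasSum.1 (Pi.hasSum.1 h.hasSum i) j
  exact h1.tsum_eq

end Model
end LQC

/-! ### Closed form of the cost and the one-step decrease. -/

namespace LQC

theorem transpose_mul_self_le_specNorm_sq {d : ℕ} (F : Matrix (Fin d) (Fin d) ℝ) :
    Fᵀ * F ≤ (specNorm F ^ 2) • (1 : Matrix (Fin d) (Fin d) ℝ) := by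
  rw [← sub_nonneg, nonneg_iff_quadratic]
  refine ⟨by simp, fun x => ?_⟩
  have hn : ∀ y : Fin d → ℝ, y ⬝ᵥ y = ‖(WithLp.toLp 2 y : Vec d)‖ ^ 2 := fun y => by
    rw [EuclideanSpace.real_norm_sq_eq]; simp [dotProduct, sq]
  have h1 := (Matrix.toEuclideanCLM (𝕜 := ℝ) F).le_opNorm (WithLp.toLp 2 x)
  rw [Matrix.toEuclideanCLM_toLp] at h1
  have h2 : x ⬝ᵥ (Fᵀ * F) *ᵥ x = (F *ᵥ x) ⬝ᵥ (F *ᵥ x) := by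
    rw [← Matrix.mulVec_mulVec, Matrix.dotProduct_mulVec, Matrix.vecMul_transpose]
  rw [Matrix.sub_mulVec, dotProduct_sub, Matrix.smul_mulVec, Matrix.one_mulVec, dotProduct_smul,
    h2, hn, hn, sub_nonneg, smul_eq_mul, ← mul_pow]
  exact pow_le_pow_left₀ (norm_nonneg _) h1 2

theorem le_of_smul_one_le {d : ℕ} (hd : 0 < d) {c c' : ℝ}
    (h : c • (1 : Matrix (Fin d) (Fin d) ℝ) ≤ c' • (1 : Matrix (Fin d) (Fin d) ℝ)) : c ≤ c' := by
  rw [smul_one_eq_diagonal, smul_one_eq_diagonal, diagonal_le_diagonal_iff] at h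
  exact h ⟨0, hd⟩

/-- At the minimizer the normalized matrix is the identity, so `covObjective_sub_le` with `N = 1`
has right-hand side zero. -/
theorem covObjective_minimizer_le {ι : Type*} [Fintype ι] [DecidableEq ι] {τ : ℝ} (hτ : 0 < τ)
    {G S : Matrix ι ι ℝ} (hG : G.PosDef) (hS : S.PosDef) :
    covObjective τ G ((τ / 2) • G⁻¹) ≤ covObjective τ G S := by
  have hm : ((τ / 2) • G⁻¹).PosDef := hG.inv.smul (by positivity)
  have hGG : G * G⁻¹ = 1 := Matrix.mul_nonsing_inv _ hG.det_pos.ne'.isUnit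
  have h := covObjective_sub_le (N := 1) hτ hG hm hS ?_ ?_
  · simp only [Matrix.trace_one, Matrix.det_one, Real.log_one] at h
    linarith
  · rw [Matrix.mul_smul, hGG, Matrix.trace_smul, smul_eq_mul, ← mul_assoc]
    rw [div_mul_div_comm, mul_comm 2 τ, div_self (by positivity), one_mul]
  · have h1 : G.det * G⁻¹.det = 1 := by rw [← Matrix.det_mul, hGG, Matrix.det_one]
    rw [Matrix.det_smul, mul_left_comm G.det, h1, mul_one, ← mul_pow, div_mul_div_comm,
      mul_comm 2 τ, div_self (by positivity), one_pow, Matrix.det_one]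

/-- The trace inequality for `(2s/τ)S`. Divided by `1 - γ`, the bound becomes the constant `M_τ`. -/
theorem covObjective_ge {k : ℕ} {τ s : ℝ} (hτ : 0 < τ) (hs : 0 < s)
    {G S : Matrix (Fin k) (Fin k) ℝ} (hG : s • (1 : Matrix (Fin k) (Fin k) ℝ) ≤ G)
    (hS : S.PosDef) :
    τ * k / 2 * Real.log (s / (Real.pi * τ)) ≤
      covObjective τ G S - τ / 2 * (k + k * Real.log (2 * Real.pi)) := by
  have h1 := card_add_log_det_le_trace (hS.smul (by positivity : 0 < 2 * s / τ))
  have h2 := trace_mul_le hG hS.posSemidef.nonneg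
  rw [Matrix.smul_mul, Matrix.one_mul, Matrix.trace_smul, smul_eq_mul] at h2
  have hp : 0 < 2 * s / τ := by positivity
  rw [Matrix.det_smul, Real.log_mul (pow_pos hp _).ne' hS.det_pos.ne', Real.log_pow,
    Matrix.trace_smul, smul_eq_mul, Fintype.card_fin] at h1
  have h3 : Real.log (s / (Real.pi * τ)) = Real.log (2 * s / τ) - Real.log (2 * Real.pi) := by
    rw [← Real.log_div hp.ne' (by positivity)]
    congr 1
    field_simp
  have h4 := mul_le_mul_of_nonneg_left h1 (by positivity : 0 ≤ τ / 2)
  have h5 : τ / 2 * (2 * s / τ * S.trace) = s * S.trace := by field_simp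
  rw [h5] at h4
  rw [covObjective, h3]
  linarith

namespace Model

variable {n k : ℕ} (𝓜 : Model n k) {K : Matrix (Fin k) (Fin n) ℝ} {S : Matrix (Fin k) (Fin k) ℝ}

/-- `R + γ Bᵀ P B`. -/
def controlHessian (P : Matrix (Fin n) (Fin n) ℝ) : Matrix (Fin k) (Fin k) ℝ :=
  𝓜.R + 𝓜.γ • (𝓜.Bᵀ * P * 𝓜.B)

variable {𝓜} in
theorem R_transpose : 𝓜.Rᵀ = 𝓜.R := transpose_eq_of_nonneg 𝓜.R_posDef.posSemidef.nonneg

theorem le_controlHessian {P : Matrix (Fin n) (Fin n) ℝ} (hP : 0 ≤ P) :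
    sigmaMin 𝓜.R • (1 : Matrix (Fin k) (Fin k) ℝ) ≤ 𝓜.controlHessian P :=
  (sigmaMin_smul_one_le 𝓜.R_posDef.posSemidef.nonneg).trans
    (le_add_of_nonneg_right (smul_matrix_nonneg (conj_nonneg hP _) 𝓜.γ_pos.le))

theorem controlHessian_posDef {P : Matrix (Fin n) (Fin n) ℝ} (hP : 0 ≤ P) :
    (𝓜.controlHessian P).PosDef :=
  𝓜.R_posDef.add_posSemidef (Matrix.nonneg_iff_posSemidef.1
    (smul_matrix_nonneg (conj_nonneg hP _) 𝓜.γ_pos.le))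

theorem controlHessian_le {P : Matrix (Fin n) (Fin n) ℝ} (hP : 0 ≤ P) :
    𝓜.controlHessian P ≤ (specNorm 𝓜.R + 𝓜.γ * (specNorm (𝓜.Bᵀ * 𝓜.B) * P.trace)) •
      (1 : Matrix (Fin k) (Fin k) ℝ) := by
  have h1 := le_specNorm_smul_one 𝓜.R_transpose
  have h2 := conj_le (le_trace_smul_one hP) 𝓜.B
  rw [Matrix.mul_smul, Matrix.smul_mul, Matrix.mul_one] at h2
  have h3 := smul_matrix_le (le_specNorm_smul_one
    (transpose_eq_of_nonneg (transpose_mul_self_nonneg 𝓜.B))) (trace_nonneg_of_nonneg hP)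
  have h4 := smul_matrix_le (h2.trans h3) 𝓜.γ_pos.le
  rw [controlHessian, add_smul]
  refine add_le_add h1 (h4.trans (le_of_eq ?_))
  rw [smul_smul, smul_smul]
  congr 1; ring

theorem valueMatrix_nonneg (h : 𝓜.FiniteValue K) : 0 ≤ 𝓜.valueMatrix K :=
  hasSum_matrix_nonneg (Summable.hasSum h) (lyapTerm_nonneg 𝓜.γ_pos.le (𝓜.stageMatrix_nonneg K))

/-- Action noise costs `tr(RS)` now and `γ tr(P B S Bᵀ)` later; the two merge into `tr(GS)`, so all
dependence on `S` sits in `covObjective`. -/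
theorem stageConst_add (hS : S.PosDef) (P : Matrix (Fin n) (Fin n) ℝ) :
    𝓜.γ * (P * (𝓜.B * S * 𝓜.Bᵀ)).trace + 𝓜.stageConst S =
      covObjective 𝓜.τ (𝓜.controlHessian P) S -
        𝓜.τ / 2 * (k + k * Real.log (2 * Real.pi)) := by
  have h1 : (𝓜.Bᵀ * P * 𝓜.B * S).trace = (P * (𝓜.B * S * 𝓜.Bᵀ)).trace := by
    rw [← Matrix.mul_assoc, Matrix.trace_mul_comm (P * (𝓜.B * S))]
    simp only [Matrix.mul_assoc]
  rw [stageConst, covObjective, controlHessian, Matrix.add_mul, Matrix.trace_add, Matrix.smul_mul,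
    Matrix.trace_smul, h1, logNorm, Real.log_mul (by positivity) hS.det_pos.ne', Real.log_pow,
    smul_eq_mul]
  ring

/-- The cost in terms of the value matrix. -/
noncomputable def closedCost (P : Matrix (Fin n) (Fin n) ℝ) (S : Matrix (Fin k) (Fin k) ℝ) : ℝ :=
  (P * secondMoment 𝓜.init).trace + 𝓜.γ / (1 - 𝓜.γ) * (P * 𝓜.W).trace +
    (1 - 𝓜.γ)⁻¹ * (covObjective 𝓜.τ (𝓜.controlHessian P) S -
      𝓜.τ / 2 * (k + k * Real.log (2 * Real.pi)))

theorem closedCost_eq (hS : S.PosDef) (P : Matrix (Fin n) (Fin n) ℝ) :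
    (P * secondMoment 𝓜.init).trace +
      𝓜.γ / (1 - 𝓜.γ) * (P * (𝓜.B * S * 𝓜.Bᵀ + 𝓜.W)).trace +
        (1 - 𝓜.γ)⁻¹ * 𝓜.stageConst S = 𝓜.closedCost P S := by
  rw [closedCost, ← stageConst_add _ hS, Matrix.mul_add, Matrix.trace_add]
  ring

theorem costE_eq_closedCost (hS : S.PosDef) (h : 𝓜.FiniteValue K) :
    𝓜.costE K S = (𝓜.closedCost (𝓜.valueMatrix K) S : EReal) := by
  rw [costE_eq_of_finiteValue _ _ _ hS h, closedCost_eq _ hS]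

theorem cost_eq_closedCost (hS : S.PosDef) (h : 𝓜.FiniteValue K) :
    𝓜.cost K S = 𝓜.closedCost (𝓜.valueMatrix K) S := by
  rw [cost, costE_eq_closedCost _ hS h, EReal.toReal_coe]

/-- A performance-difference formula: `P` is arbitrary, and the correction is its Bellman residual
under `K` weighted by visited states. It is used with `P` the value matrix of another gain, and with
`P = 0` for finiteness alone. -/
theorem costE_eq_closedCost_add (hS : S.PosDef)
    (h : Summable fun t => 𝓜.γ ^ t • 𝓜.stateMoment K S t) (P : Matrix (Fin n) (Fin n) ℝ) :
    𝓜.costE K S = ((𝓜.closedCost P S +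
      ((𝓜.Q + Kᵀ * 𝓜.R * K + 𝓜.γ • ((𝓜.A - 𝓜.B * K)ᵀ * P * (𝓜.A - 𝓜.B * K)) - P) *
        𝓜.stateCorr K S).trace : ℝ) : EReal) := by
  have h1 := (𝓜.isMomentSeq_stateMoment K S hS.posSemidef).hasSum_trace_residual
    (M := 𝓜.Q + Kᵀ * 𝓜.R * K) 𝓜.γ_pos.le 𝓜.γ_lt_one h P
  rw [costE_eq_of_hasSum _ _ _ hS h1, ← closedCost_eq _ hS, stateCorr_eq_tsum _ _ _ hS.posSemidef h]
  congr 1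
  have : 𝓜.stateMoment K S 0 = secondMoment 𝓜.init := rfl
  rw [this]
  ring

/-- Being linear in `tr P`, this bound inverts to control `P`, and with it the Hessian, by the cost;
it is the source of the second entry of `radius`. -/
theorem closedCost_ge {P : Matrix (Fin n) (Fin n) ℝ} (hP : 0 ≤ P) (hR : 0 < sigmaMin 𝓜.R)
    (hS : S.PosDef) :
    (𝓜.μ + 𝓜.γ / (1 - 𝓜.γ) * sigmaMin 𝓜.W) * P.trace + 𝓜.entropyConst ≤ 𝓜.closedCost P S := by
  have hγ : 0 < 1 - 𝓜.γ := sub_pos.2 𝓜.γ_lt_one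
  have h1 := trace_mul_le' hP 𝓜.μ_smul_one_le
  have h2 := trace_mul_le' hP (sigmaMin_smul_one_le 𝓜.W_nonneg)
  rw [Matrix.mul_smul, Matrix.mul_one, Matrix.trace_smul, smul_eq_mul] at h1 h2
  have h3 := mul_le_mul_of_nonneg_left h2 (div_nonneg 𝓜.γ_pos.le hγ.le)
  have h4 := mul_le_mul_of_nonneg_left (covObjective_ge 𝓜.τ_pos hR (𝓜.le_controlHessian hP) hS)
    (inv_nonneg.2 hγ.le)
  have h5 : 𝓜.entropyConst =
      (1 - 𝓜.γ)⁻¹ * (𝓜.τ * k / 2 * Real.log (sigmaMin 𝓜.R / (Real.pi * 𝓜.τ))) := by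
    rw [entropyConst]; field_simp
  rw [closedCost, h5]
  linarith

/-- Along parameters whose cost does not exceed the initial one, the Hessian is bounded by the
radius. -/
theorem controlHessian_le_of_cost_le (hμ : 0 < 𝓜.μ) (hR : 0 < sigmaMin 𝓜.R) {r : ℝ}
    {K₀ : Matrix (Fin k) (Fin n) ℝ} {S₀ : Matrix (Fin k) (Fin k) ℝ} (hr : 𝓜.radius K₀ S₀ ≤ r)
    {P : Matrix (Fin n) (Fin n) ℝ} (hP : 0 ≤ P) (hS : S.PosDef)
    (hC : 𝓜.closedCost P S ≤ 𝓜.cost K₀ S₀) :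
    𝓜.controlHessian P ≤ r • (1 : Matrix (Fin k) (Fin k) ℝ) := by
  refine (𝓜.controlHessian_le hP).trans (smul_one_mono (le_trans ?_ ((le_max_right _ _).trans hr)))
  have h1 := 𝓜.closedCost_ge hP hR hS
  have hγ : 0 < 1 - 𝓜.γ := sub_pos.2 𝓜.γ_lt_one
  have hm : 0 < 𝓜.μ + 𝓜.γ / (1 - 𝓜.γ) * sigmaMin 𝓜.W :=
    add_pos_of_pos_of_nonneg hμ (mul_nonneg (div_nonneg 𝓜.γ_pos.le hγ.le) (sigmaMin_nonneg _))
  have h2 : P.trace ≤ (𝓜.cost K₀ S₀ - 𝓜.entropyConst) /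
      (𝓜.μ + 𝓜.γ / (1 - 𝓜.γ) * sigmaMin 𝓜.W) := by
    rw [le_div_iff₀ hm]; linarith
  rw [mul_div_assoc]
  have := specNorm_nonneg (𝓜.Bᵀ * 𝓜.B)
  have := 𝓜.γ_pos
  gcongr

/-- The old value matrix is a supersolution of the new gain's Lyapunov equation with slack `r⁻¹EᵀE`,
giving both finiteness and the decrease. -/
theorem gradientStep_valueMatrix_le (h : 𝓜.FiniteValue K) {r : ℝ} (hr : 0 < r)
    (hG : 𝓜.controlHessian (𝓜.valueMatrix K) ≤ r • (1 : Matrix (Fin k) (Fin k) ℝ)) :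
    𝓜.FiniteValue (K - r⁻¹ • 𝓜.gradGain K) ∧
      𝓜.valueMatrix (K - r⁻¹ • 𝓜.gradGain K) ≤
        𝓜.valueMatrix K - r⁻¹ • ((𝓜.gradGain K)ᵀ * 𝓜.gradGain K) := by
  have hP := 𝓜.valueMatrix_nonneg h
  have hb := bellman_add_eq (A := 𝓜.A) (Q := 𝓜.Q) (B := 𝓜.B) (transpose_eq_of_nonneg hP)
    𝓜.R_transpose 𝓜.γ K (-(r⁻¹ • 𝓜.gradGain K))
  rw [← sub_eq_add_neg, ← 𝓜.valueMatrix_eq K h] at hb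
  have hres := gradient_step_le hr hG (𝓜.gradGain K)
  have h1 : 𝓜.Q + (K - r⁻¹ • 𝓜.gradGain K)ᵀ * 𝓜.R * (K - r⁻¹ • 𝓜.gradGain K) +
      𝓜.γ • ((𝓜.A - 𝓜.B * (K - r⁻¹ • 𝓜.gradGain K))ᵀ * 𝓜.valueMatrix K *
        (𝓜.A - 𝓜.B * (K - r⁻¹ • 𝓜.gradGain K))) ≤
      𝓜.valueMatrix K - r⁻¹ • ((𝓜.gradGain K)ᵀ * 𝓜.gradGain K) := by
    rw [hb, sub_eq_add_neg]
    exact add_le_add le_rfl hres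
  exact summable_lyapTerm_of_le 𝓜.γ_pos.le (𝓜.stageMatrix_nonneg _) hP h1
    (sub_le_self _ (smul_matrix_nonneg (transpose_mul_self_nonneg _) (inv_nonneg.2 hr.le)))

theorem closedCost_mono {P P' : Matrix (Fin n) (Fin n) ℝ} (h : P ≤ P') (hS : S.PosDef) :
    𝓜.closedCost P S + ((P' - P) * secondMoment 𝓜.init).trace ≤ 𝓜.closedCost P' S := by
  have hγ : 0 < 1 - 𝓜.γ := sub_pos.2 𝓜.γ_lt_one
  have h2 := mul_le_mul_of_nonneg_left (trace_mul_le h 𝓜.W_nonneg) (div_nonneg 𝓜.γ_pos.le hγ.le)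
  have h3 : 𝓜.controlHessian P ≤ 𝓜.controlHessian P' :=
    add_le_add le_rfl (smul_matrix_le (conj_le h _) 𝓜.γ_pos.le)
  have h4 := mul_le_mul_of_nonneg_left (trace_mul_le h3 hS.posSemidef.nonneg)
    (inv_nonneg.2 hγ.le)
  rw [closedCost, closedCost, covObjective, covObjective, Matrix.sub_mul, Matrix.trace_sub]
  linarith

/-- Gradient dominance relative to a stable comparison policy. -/
theorem closedCost_sub_le (h : 𝓜.FiniteValue K) (hR : 0 < sigmaMin 𝓜.R)
    {K' : Matrix (Fin k) (Fin n) ℝ} {S' : Matrix (Fin k) (Fin k) ℝ} (hS' : S'.PosDef)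
    (hs : Summable fun t => 𝓜.γ ^ t • 𝓜.stateMoment K' S' t) :
    𝓜.closedCost (𝓜.valueMatrix K) S - 𝓜.cost K' S' ≤
      (1 - 𝓜.γ)⁻¹ * (covObjective 𝓜.τ (𝓜.controlHessian (𝓜.valueMatrix K)) S -
        covObjective 𝓜.τ (𝓜.controlHessian (𝓜.valueMatrix K)) S') +
      specNorm (𝓜.stateCorr K' S') / sigmaMin 𝓜.R *
        ((𝓜.gradGain K)ᵀ * 𝓜.gradGain K).trace := by
  have hP := 𝓜.valueMatrix_nonneg h
  have hb := bellman_add_eq (A := 𝓜.A) (Q := 𝓜.Q) (B := 𝓜.B) (transpose_eq_of_nonneg hP)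
    𝓜.R_transpose 𝓜.γ K (K' - K)
  rw [add_sub_cancel, ← 𝓜.valueMatrix_eq K h] at hb
  have hres := residual_ge hR (𝓜.le_controlHessian hP) (𝓜.gradGain K) (K' - K)
  have hC : 0 ≤ 𝓜.stateCorr K' S' := by
    rw [stateCorr_eq_tsum _ _ _ hS'.posSemidef hs]
    exact hasSum_matrix_nonneg hs.hasSum fun t => smul_matrix_nonneg
      ((𝓜.isMomentSeq_stateMoment K' S' hS'.posSemidef).nonneg t) (pow_nonneg 𝓜.γ_pos.le t)
  have h1 : -(sigmaMin 𝓜.R)⁻¹ * (((𝓜.gradGain K)ᵀ * 𝓜.gradGain K) * 𝓜.stateCorr K' S').trace ≤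
      ((𝓜.Q + K'ᵀ * 𝓜.R * K' + 𝓜.γ • ((𝓜.A - 𝓜.B * K')ᵀ * 𝓜.valueMatrix K * (𝓜.A - 𝓜.B * K')) -
        𝓜.valueMatrix K) * 𝓜.stateCorr K' S').trace := by
    rw [hb, add_sub_cancel_left]
    refine le_trans (le_of_eq ?_) (trace_mul_le hres hC)
    rw [Matrix.neg_mul, Matrix.smul_mul, Matrix.trace_neg, Matrix.trace_smul, smul_eq_mul, neg_mul]
  have h2 := trace_mul_le' (transpose_mul_self_nonneg (𝓜.gradGain K))
    (le_specNorm_smul_one (transpose_eq_of_nonneg hC))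
  rw [Matrix.mul_smul, Matrix.mul_one, Matrix.trace_smul, smul_eq_mul] at h2
  have h3 := mul_le_mul_of_nonneg_left h2 (inv_nonneg.2 hR.le)
  -- The comparison cost is evaluated with the value matrix of `K`, so the gap is a residual and a
  -- difference of covariance objectives with the same Hessian.
  have h4 : 𝓜.cost K' S' = _ := congrArg EReal.toReal
    (𝓜.costE_eq_closedCost_add hS' hs (𝓜.valueMatrix K))
  rw [EReal.toReal_coe] at h4
  rw [h4, closedCost, closedCost, div_eq_mul_inv (specNorm _)]
  linarith

/-- One step of the method decreases the gap to any stable comparison policy. -/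
theorem step_decrease (hμ : 0 < 𝓜.μ) (hτ : 𝓜.τ ≤ 2 * sigmaMin 𝓜.R) (h : 𝓜.FiniteValue K)
    {r a : ℝ} (hr : 0 < r) (ha : a = 𝓜.τ / (2 * r)) (ha1 : a ≤ 1)
    (hG : 𝓜.controlHessian (𝓜.valueMatrix K) ≤ r • (1 : Matrix (Fin k) (Fin k) ℝ))
    (hS : a • (1 : Matrix (Fin k) (Fin k) ℝ) ≤ S) (hS1 : S ≤ 1)
    {K' : Matrix (Fin k) (Fin n) ℝ} {S' : Matrix (Fin k) (Fin k) ℝ}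
    (hK' : K' = K - r⁻¹ • 𝓜.gradGain K)
    (hS' : S' = covStep 𝓜.τ (𝓜.τ / (2 * r ^ 2)) (𝓜.controlHessian (𝓜.valueMatrix K)) S) :
    𝓜.FiniteValue K' ∧ (a • (1 : Matrix (Fin k) (Fin k) ℝ) ≤ S' ∧ S' ≤ 1) ∧
      𝓜.closedCost (𝓜.valueMatrix K') S' ≤ 𝓜.closedCost (𝓜.valueMatrix K) S ∧
      ∀ (K₁ : Matrix (Fin k) (Fin n) ℝ) (S₁ : Matrix (Fin k) (Fin k) ℝ) (z : ℝ), S₁.PosDef →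
        (Summable fun t => 𝓜.γ ^ t • 𝓜.stateMoment K₁ S₁ t) → 0 ≤ z →
        z * (specNorm (𝓜.stateCorr K₁ S₁) / sigmaMin 𝓜.R) ≤ 𝓜.μ / r →
        z ≤ a ^ 2 * (sigmaMin 𝓜.R / r) / 2 →
        𝓜.closedCost (𝓜.valueMatrix K') S' - 𝓜.cost K₁ S₁ ≤
          (1 - z) * (𝓜.closedCost (𝓜.valueMatrix K) S - 𝓜.cost K₁ S₁) := by
  have hτ0 := 𝓜.τ_pos
  have hR : 0 < sigmaMin 𝓜.R := by linarith
  have hγ : 0 < 1 - 𝓜.γ := sub_pos.2 𝓜.γ_lt_one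
  have ha0 : 0 < a := by rw [ha]; positivity
  have hP := 𝓜.valueMatrix_nonneg h
  obtain ⟨hfin, hval⟩ := 𝓜.gradientStep_valueMatrix_le h hr hG
  rw [← hK'] at hfin hval
  set P := 𝓜.valueMatrix K with hPdef
  set G := 𝓜.controlHessian P with hGdef
  have hGl := 𝓜.le_controlHessian hP
  -- The assumption `τ ≤ 2σ_min(R)` supplies the lower bound `τ/2` on the Hessian.
  have hmem := covStep_mem hr hτ0 ha ha1
    ((smul_one_mono (by linarith)).trans hGl) hG hS hS1
  rw [← hS'] at hmem
  have hS'pd := posDef_of_smul_one_le ha0 hmem.1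
  have hSpd := posDef_of_smul_one_le ha0 hS
  have hGpd := 𝓜.controlHessian_posDef hP
  have hmin : ((𝓜.τ / 2) • G⁻¹).PosDef := hGpd.inv.smul (by positivity)
  have hdec := covStep_decrease hr hτ0 ha ha1 hR hGl hG hS hS1 hmin
  rw [← hS'] at hdec
  set Sm := (𝓜.τ / 2) • G⁻¹ with hSm
  have hgap0 : 0 ≤ covObjective 𝓜.τ G S - covObjective 𝓜.τ G Sm :=
    sub_nonneg.2 (covObjective_minimizer_le hτ0 hGpd hSpd)
  set e := ((𝓜.gradGain K)ᵀ * 𝓜.gradGain K).trace with he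
  have he0 : 0 ≤ e := trace_nonneg_of_nonneg (transpose_mul_self_nonneg _)
  -- The covariance step uses the old value matrix, so `S` is changed first at fixed `P`, and `P` is
  -- then lowered at fixed `S'`.
  have hstep : 𝓜.closedCost (𝓜.valueMatrix K') S' ≤ 𝓜.closedCost P S - 𝓜.μ / r * e -
      (1 - 𝓜.γ)⁻¹ * (a ^ 2 * (sigmaMin 𝓜.R / r) / 2 *
        (covObjective 𝓜.τ G S - covObjective 𝓜.τ G Sm)) := by
    have hle : 𝓜.valueMatrix K' ≤ P := hval.trans (sub_le_self _
      (smul_matrix_nonneg (transpose_mul_self_nonneg _) (inv_nonneg.2 hr.le)))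
    have h1 := 𝓜.closedCost_mono hle hS'pd
    have h2 : r⁻¹ • ((𝓜.gradGain K)ᵀ * 𝓜.gradGain K) ≤ P - 𝓜.valueMatrix K' := le_sub_comm.1 hval
    have h3 := trace_mul_le h2 𝓜.initMoment_nonneg
    have h4 := trace_mul_le' (smul_matrix_nonneg (transpose_mul_self_nonneg (𝓜.gradGain K))
      (inv_nonneg.2 hr.le)) 𝓜.μ_smul_one_le
    rw [Matrix.mul_smul, Matrix.mul_one, Matrix.trace_smul, Matrix.trace_smul, smul_eq_mul,
      smul_eq_mul, ← he, ← mul_assoc, ← div_eq_mul_inv] at h4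
    have h5 := mul_le_mul_of_nonneg_left hdec (inv_nonneg.2 hγ.le)
    have h6 : 𝓜.closedCost P S' - 𝓜.closedCost P S =
        (1 - 𝓜.γ)⁻¹ * (covObjective 𝓜.τ G S' - covObjective 𝓜.τ G S) := by
      rw [closedCost, closedCost]; ring
    linarith
  have hγi := inv_pos.2 hγ
  refine ⟨hfin, hmem, ?_, fun K₁ S₁ z hS₁ hs hz hz1 hz2 => ?_⟩
  · have h1 : 0 ≤ 𝓜.μ / r * e := by positivity
    have h2 : 0 ≤ (1 - 𝓜.γ)⁻¹ * (a ^ 2 * (sigmaMin 𝓜.R / r) / 2 *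
        (covObjective 𝓜.τ G S - covObjective 𝓜.τ G Sm)) := by positivity
    linarith
  · have h1 := 𝓜.closedCost_sub_le (S := S) h hR hS₁ hs
    -- Replacing `S₁` by the minimizer `Sm` only enlarges the covariance gap, which is then the
    -- quantity controlled by the step.
    have h2 := mul_le_mul_of_nonneg_left (covObjective_minimizer_le hτ0 hGpd hS₁) hγi.le
    have h3 := mul_le_mul_of_nonneg_left h1 hz
    have h4 := mul_le_mul_of_nonneg_right hz1 he0
    have h5 := mul_le_mul_of_nonneg_right hz2 (mul_nonneg hγi.le hgap0)
    have h6 := mul_le_mul_of_nonneg_left h2 hz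
    simp only [← hPdef, ← hGdef, ← he, ← hSm] at h3 h6
    linarith

end Model

end LQC

/-! ### The comparison policy and the main theorem. -/

namespace LQC.Model

variable {n k : ℕ} (𝓜 : Model n k) {K : Matrix (Fin k) (Fin n) ℝ} {S : Matrix (Fin k) (Fin k) ℝ}

/-- Discounted second moments are summable under a gain that contracts faster than `1/√γ`. -/
theorem summable_stateMoment (hS : S.PosSemidef) {ρ : ℝ} (hρ₀ : 0 < ρ)
    (hρ₁ : ρ < 1 / Real.sqrt 𝓜.γ) (hρ : specNorm (𝓜.A - 𝓜.B * K) ≤ ρ) :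
    Summable fun t => 𝓜.γ ^ t • 𝓜.stateMoment K S t := by
  have hγ := 𝓜.γ_pos
  refine (𝓜.isMomentSeq_stateMoment K S hS).summable_smul (q := ρ ^ 2) hγ.le 𝓜.γ_lt_one
    ((transpose_mul_self_le_specNorm_sq _).trans
      (smul_one_mono (pow_le_pow_left₀ (specNorm_nonneg _) hρ 2))) ?_
  rw [lt_div_iff₀ (Real.sqrt_pos.2 hγ)] at hρ₁
  calc 𝓜.γ * ρ ^ 2 = (ρ * Real.sqrt 𝓜.γ) ^ 2 := by rw [mul_pow, Real.sq_sqrt hγ.le]; ring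
    _ < 1 := pow_lt_one₀ (by positivity) hρ₁ two_ne_zero

theorem optCov_posDef {P : Matrix (Fin n) (Fin n) ℝ} (hP : P.PosSemidef) : (𝓜.optCov P).PosDef :=
  (𝓜.controlHessian_posDef hP.nonneg).inv.smul (half_pos 𝓜.τ_pos)

/-- The term at time `0` already dominates `μI`. This keeps the denominator in `ζ` positive. -/
theorem μ_le_specNorm_stateCorr (hμ : 0 < 𝓜.μ) (hS : S.PosSemidef)
    (hs : Summable fun t => 𝓜.γ ^ t • 𝓜.stateMoment K S t) : 𝓜.μ ≤ specNorm (𝓜.stateCorr K S) := by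
  have hseq := 𝓜.isMomentSeq_stateMoment K S hS
  have hn := pos_of_sigmaMin_pos hμ
  have h0 : ∀ t, 0 ≤ 𝓜.γ ^ t • 𝓜.stateMoment K S t := fun t =>
    smul_matrix_nonneg (hseq.nonneg t) (pow_nonneg 𝓜.γ_pos.le t)
  have h1 : secondMoment 𝓜.init ≤ 𝓜.stateCorr K S := by
    have h2 := (summable_nat_add_iff 1).2 hs
    rw [stateCorr_eq_tsum _ _ _ hS hs, hs.tsum_eq_zero_add, pow_zero, one_smul]
    exact le_add_of_nonneg_right (hasSum_matrix_nonneg h2.hasSum fun t => h0 _)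
  exact le_of_smul_one_le hn ((𝓜.μ_smul_one_le.trans h1).trans (le_specNorm_smul_one
    (transpose_eq_of_nonneg (𝓜.initMoment_nonneg.trans h1))))

end LQC.Model

theorem theorem2 {n k : ℕ} (𝓜 : LQC.Model n k)
    -- standing assumptions: `μ > 0`, and `‖A - BK*‖ ≤ ρ < 1/√γ`
    (hμ : 0 < 𝓜.μ)
    (P Kstar Sstar) (hP : 𝓜.IsRiccatiSolution P)
    (hKstar : Kstar = 𝓜.optGain P) (hSstar : Sstar = 𝓜.optCov P)
    (ρ : ℝ) (hρ₀ : 0 < ρ) (hρ₁ : ρ < 1 / Real.sqrt 𝓜.γ)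
    (hρ : LQC.specNorm (𝓜.A - 𝓜.B * Kstar) ≤ ρ)
    -- `τ ∈ (0, 2 σ_min(R)]`
    (hτ : 𝓜.τ ≤ 2 * LQC.sigmaMin 𝓜.R)
    -- initial parameters of finite cost, with `0 ≺ Σ⁽⁰⁾ ⪯ I`
    (K₀ : Matrix (Fin k) (Fin n) ℝ) (S₀ : Matrix (Fin k) (Fin k) ℝ)
    (hS₀ : S₀.PosDef) (hS₀_le : (1 - S₀).PosSemidef) (hC₀ : 𝓜.costE K₀ S₀ < ⊤)
    -- `r₀` is the explicit constant `radius K₀ S₀` or any larger number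
    (r₀ : ℝ) (hr₀ : 𝓜.radius K₀ S₀ ≤ r₀)
    -- step sizes and iterates
    (η₁ η₂ : ℝ) (hη₁ : η₁ = 1 / (2 * r₀)) (hη₂ : η₂ = 𝓜.τ * (1 - 𝓜.γ) / (2 * r₀ ^ 2))
    (K : ℕ → Matrix (Fin k) (Fin n) ℝ) (S : ℕ → Matrix (Fin k) (Fin k) ℝ)
    (hKS : ∀ t, (K t, S t) = 𝓜.rpg η₁ η₂ (K₀, S₀) t)
    -- the contraction rate
    (ζ : ℝ) (hζ : ζ = min
      (𝓜.μ * LQC.sigmaMin 𝓜.R / (LQC.specNorm (𝓜.stateCorr Kstar Sstar) * r₀))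
      (𝓜.τ ^ 2 * LQC.sigmaMin 𝓜.R / (8 * r₀ ^ 3))) :
    -- the costs are finite
    (𝓜.costE Kstar Sstar ≠ ⊤ ∧ 𝓜.costE Kstar Sstar ≠ ⊥) ∧
    (∀ t, 𝓜.costE (K t) (S t) ≠ ⊤ ∧ 𝓜.costE (K t) (S t) ≠ ⊥) ∧
    -- the covariances stay in `aI ⪯ Σ ⪯ I` with `a = τ / (2 r₀)`
    (∀ t, (S t - (𝓜.τ / (2 * r₀)) • (1 : Matrix (Fin k) (Fin k) ℝ)).PosSemidef ∧
      (1 - S t).PosSemidef) ∧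
    -- linear convergence
    (0 < ζ ∧ ζ < 1 ∧ ∀ t, 𝓜.cost (K (t + 1)) (S (t + 1)) - 𝓜.cost Kstar Sstar ≤
      (1 - ζ) * (𝓜.cost (K t) (S t) - 𝓜.cost Kstar Sstar)) ∧
    -- iteration bound
    (∀ ε : ℝ, 0 < ε → ∀ N : ℕ,
      max (LQC.specNorm (𝓜.stateCorr Kstar Sstar) * r₀ / (𝓜.μ * LQC.sigmaMin 𝓜.R))
          (8 * r₀ ^ 3 / (𝓜.τ ^ 2 * LQC.sigmaMin 𝓜.R)) *
        Real.log ((𝓜.cost K₀ S₀ - 𝓜.cost Kstar Sstar) / ε) ≤ N →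
      𝓜.cost (K N) (S N) - 𝓜.cost Kstar Sstar ≤ ε) := by
  have hτ0 := 𝓜.τ_pos
  have hγ1 : 0 < 1 - 𝓜.γ := sub_pos.2 𝓜.γ_lt_one
  have hR : 0 < LQC.sigmaMin 𝓜.R := by linarith
  have hk := LQC.pos_of_sigmaMin_pos hR
  have hσ₀ := LQC.sigmaMin_pos hk hS₀
  have hr : 0 < r₀ := lt_of_lt_of_le (by positivity) ((le_max_left _ _).trans hr₀)
  obtain ⟨a, ha⟩ : ∃ a, a = 𝓜.τ / (2 * r₀) := ⟨_, rfl⟩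
  have ha0 : 0 < a := by rw [ha]; positivity
  -- The first entry of `radius` is exactly the condition `a ≤ σ_min(Σ⁽⁰⁾)`.
  have hS₀l : a • (1 : Matrix (Fin k) (Fin k) ℝ) ≤ S₀ := by
    refine (LQC.smul_one_mono ?_).trans (LQC.sigmaMin_smul_one_le hS₀.posSemidef.nonneg)
    have h1 : 𝓜.τ / (2 * LQC.sigmaMin S₀) ≤ r₀ := (le_max_left _ _).trans hr₀
    rw [div_le_iff₀ (by positivity)] at h1
    rw [ha, div_le_iff₀ (by positivity)]
    linarith
  have ha1 : a ≤ 1 := LQC.le_of_smul_one_le hk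
    ((hS₀l.trans (Matrix.le_iff.2 hS₀_le)).trans (one_smul ℝ _).ge)
  have hpair0 : K 0 = K₀ ∧ S 0 = S₀ := Prod.ext_iff.1 (hKS 0)
  have hsucc : ∀ t, K (t + 1) = K t - r₀⁻¹ • 𝓜.gradGain (K t) ∧
      S (t + 1) = LQC.covStep 𝓜.τ (𝓜.τ / (2 * r₀ ^ 2))
        (𝓜.controlHessian (𝓜.valueMatrix (K t))) (S t) := fun t => by
    have h1 : (K (t + 1), S (t + 1)) = 𝓜.rpgStep η₁ η₂ (K t, S t) := by
      rw [hKS, hKS, LQC.Model.rpg, LQC.Model.rpg, Function.iterate_succ_apply']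
    have e1 : 2 * η₁ = r₀⁻¹ := by rw [hη₁]; field_simp
    have e2 : η₂ / (1 - 𝓜.γ) = 𝓜.τ / (2 * r₀ ^ 2) := by rw [hη₂]; field_simp
    rw [LQC.Model.rpgStep, e1, e2] at h1
    exact Prod.ext_iff.1 h1
  have hfin₀ := 𝓜.finiteValue_of_costE_lt_top K₀ S₀ hS₀ hμ hC₀
  have hcost₀ := 𝓜.cost_eq_closedCost hS₀ hfin₀
  -- Cost at most `C₀` gives the Hessian bound, which validates the next step, which in turn does
  -- not raise the cost.
  have hinv : ∀ t, 𝓜.FiniteValue (K t) ∧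
      (a • (1 : Matrix (Fin k) (Fin k) ℝ) ≤ S t ∧ S t ≤ 1) ∧
      𝓜.closedCost (𝓜.valueMatrix (K t)) (S t) ≤ 𝓜.cost K₀ S₀ := fun t => by
    induction t with
    | zero =>
      rw [hpair0.1, hpair0.2]
      exact ⟨hfin₀, ⟨hS₀l, hS₀_le⟩, hcost₀.ge⟩
    | succ t ih =>
      have hG := 𝓜.controlHessian_le_of_cost_le hμ hR hr₀ (𝓜.valueMatrix_nonneg ih.1)
        (LQC.posDef_of_smul_one_le ha0 ih.2.1.1) ih.2.2
      obtain ⟨h1, h2, h3, -⟩ := 𝓜.step_decrease hμ hτ ih.1 hr ha ha1 hG ih.2.1.1 ih.2.1.2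
        (hsucc t).1 (hsucc t).2
      exact ⟨h1, h2, h3.trans ih.2.2⟩
  have hpd : ∀ t, (S t).PosDef := fun t => LQC.posDef_of_smul_one_le ha0 (hinv t).2.1.1
  have hcost : ∀ t, 𝓜.cost (K t) (S t) = 𝓜.closedCost (𝓜.valueMatrix (K t)) (S t) := fun t =>
    𝓜.cost_eq_closedCost (hpd t) (hinv t).1
  have hG : ∀ t, 𝓜.controlHessian (𝓜.valueMatrix (K t)) ≤
      r₀ • (1 : Matrix (Fin k) (Fin k) ℝ) := fun t =>
    𝓜.controlHessian_le_of_cost_le hμ hR hr₀ (𝓜.valueMatrix_nonneg (hinv t).1) (hpd t)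
      (hinv t).2.2
  have hSs : Sstar.PosDef := hSstar ▸ 𝓜.optCov_posDef hP.1
  have hsum := 𝓜.summable_stateMoment (K := Kstar) hSs.posSemidef hρ₀ hρ₁ hρ
  have hcorr : 0 < LQC.specNorm (𝓜.stateCorr Kstar Sstar) :=
    hμ.trans_le (𝓜.μ_le_specNorm_stateCorr hμ hSs.posSemidef hsum)
  have hRr : LQC.sigmaMin 𝓜.R ≤ r₀ := LQC.le_of_smul_one_le hk
    ((𝓜.le_controlHessian (𝓜.valueMatrix_nonneg (hinv 0).1)).trans (hG 0))
  have hrate : 𝓜.τ ^ 2 * LQC.sigmaMin 𝓜.R / (8 * r₀ ^ 3) =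
      a ^ 2 * (LQC.sigmaMin 𝓜.R / r₀) / 2 := by rw [ha]; field_simp; norm_num
  have hζ0 : 0 < ζ := by rw [hζ]; exact lt_min (by positivity) (by positivity)
  have hζ2 : ζ ≤ a ^ 2 * (LQC.sigmaMin 𝓜.R / r₀) / 2 := by
    rw [hζ, ← hrate]; exact min_le_right _ _
  have hζ1 : ζ < 1 := by
    have h1 : a ^ 2 ≤ 1 := pow_le_one₀ ha0.le ha1
    have h2 : LQC.sigmaMin 𝓜.R / r₀ ≤ 1 := div_le_one_of_le₀ hRr hr.le
    have h3 : a ^ 2 * (LQC.sigmaMin 𝓜.R / r₀) ≤ 1 := mul_le_one₀ h1 (by positivity) h2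
    linarith
  have hζcorr : ζ * (LQC.specNorm (𝓜.stateCorr Kstar Sstar) / LQC.sigmaMin 𝓜.R) ≤ 𝓜.μ / r₀ := by
    have h1 : ζ ≤ 𝓜.μ * LQC.sigmaMin 𝓜.R / (LQC.specNorm (𝓜.stateCorr Kstar Sstar) * r₀) := by
      rw [hζ]; exact min_le_left _ _
    calc _ ≤ 𝓜.μ * LQC.sigmaMin 𝓜.R / (LQC.specNorm (𝓜.stateCorr Kstar Sstar) * r₀) *
          (LQC.specNorm (𝓜.stateCorr Kstar Sstar) / LQC.sigmaMin 𝓜.R) := by gcongr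
      _ = _ := by field_simp
  have hdec : ∀ t, 𝓜.cost (K (t + 1)) (S (t + 1)) - 𝓜.cost Kstar Sstar ≤
      (1 - ζ) * (𝓜.cost (K t) (S t) - 𝓜.cost Kstar Sstar) := fun t => by
    rw [hcost, hcost]
    exact (𝓜.step_decrease hμ hτ (hinv t).1 hr ha ha1 (hG t) (hinv t).2.1.1 (hinv t).2.1.2
      (hsucc t).1 (hsucc t).2).2.2.2 Kstar Sstar ζ hSs hsum hζ0.le hζcorr hζ2
  refine ⟨?_, fun t => ?_, fun t => ?_, ⟨hζ0, hζ1, hdec⟩, fun ε hε N hN => ?_⟩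
  · rw [𝓜.costE_eq_closedCost_add hSs hsum 0]
    exact ⟨EReal.coe_ne_top _, EReal.coe_ne_bot _⟩
  · rw [𝓜.costE_eq_closedCost (hpd t) (hinv t).1]
    exact ⟨EReal.coe_ne_top _, EReal.coe_ne_bot _⟩
  · rw [← ha]
    exact ⟨Matrix.le_iff.1 (hinv t).2.1.1, Matrix.le_iff.1 (hinv t).2.1.2⟩
  · have hpow : ∀ t, 𝓜.cost (K t) (S t) - 𝓜.cost Kstar Sstar ≤
        (1 - ζ) ^ t * (𝓜.cost K₀ S₀ - 𝓜.cost Kstar Sstar) := fun t => by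
      induction t with
      | zero => rw [hpair0.1, hpair0.2, pow_zero, one_mul]
      | succ t ih =>
        refine (hdec t).trans ((mul_le_mul_of_nonneg_left ih (by linarith)).trans (le_of_eq ?_))
        rw [pow_succ]; ring
    refine (hpow N).trans ?_
    -- A nonpositive initial gap stays nonpositive, so the bound is immediate; otherwise the
    -- logarithm has a positive argument.
    rcases le_or_gt (𝓜.cost K₀ S₀ - 𝓜.cost Kstar Sstar) 0 with hle | hgt
    · exact (mul_nonpos_of_nonneg_of_nonpos (pow_nonneg (by linarith) N) hle).trans hε.le
    · have hmax : max (LQC.specNorm (𝓜.stateCorr Kstar Sstar) * r₀ / (𝓜.μ * LQC.sigmaMin 𝓜.R))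
          (8 * r₀ ^ 3 / (𝓜.τ ^ 2 * LQC.sigmaMin 𝓜.R)) = ζ⁻¹ := by
        rw [← inv_div (𝓜.μ * LQC.sigmaMin 𝓜.R), ← inv_div (𝓜.τ ^ 2 * LQC.sigmaMin 𝓜.R), hζ]
        rcases le_total (𝓜.μ * LQC.sigmaMin 𝓜.R /
          (LQC.specNorm (𝓜.stateCorr Kstar Sstar) * r₀))
          (𝓜.τ ^ 2 * LQC.sigmaMin 𝓜.R / (8 * r₀ ^ 3)) with h | h
        · rw [min_eq_left h, max_eq_left (inv_anti₀ (by positivity) h)]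
        · rw [min_eq_right h, max_eq_right (inv_anti₀ (by positivity) h)]
      rw [hmax, inv_mul_le_iff₀ hζ0] at hN
      -- The maximum in the iteration bound is `ζ⁻¹`, so `1 - ζ ≤ exp(-ζ)` turns linear convergence
      -- into the logarithmic count.
      have h1 : (1 - ζ) ^ N ≤ Real.exp (-(ζ * N)) := by
        calc (1 - ζ) ^ N ≤ Real.exp (-ζ) ^ N :=
              pow_le_pow_left₀ (by linarith) (Real.one_sub_le_exp_neg ζ) N
          _ = _ := by rw [← Real.exp_nat_mul]; congr 1; ring
      have h2 : Real.exp (-(ζ * N)) ≤ ε / (𝓜.cost K₀ S₀ - 𝓜.cost Kstar Sstar) := by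
        rw [← Real.exp_log (div_pos hε hgt), Real.exp_le_exp, ← inv_div, Real.log_inv]
        linarith
      calc _ ≤ ε / (𝓜.cost K₀ S₀ - 𝓜.cost Kstar Sstar) *
            (𝓜.cost K₀ S₀ - 𝓜.cost Kstar Sstar) := by gcongr; exact h1.trans h2
        _ = ε := div_mul_cancel₀ _ hgt.ne'
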